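/- **Setting.** Let $\Sigma$ be a finite set of scenarios, $\mathcal P$ the probability simplex over $\Sigma$, and $\mathcal P^{\mathrm o}=\{\mathbb P\in\mathcal P:\ \mathbb P(i)>0\ \forall i\in\Sigma\}$ its (relative) interior. Let $\mathcal X$ be a nonempty compact space of decisions and $\ell:\mathcal X\times\Sigma\to\mathbb R$ a loss such that $x\mapsto\ell(x,i)$ is continuous for every $i\in\Sigma$. Put $$c(x,\mathbb P)=\sum_{i\in\Sigma}\mathbb P(i)\,\ell(x,i),\qquad \mathrm{Var}_{\mathbb P}(\ell(x,\xi))=\sum_{i\in\Sigma}\mathbb P(i)\,(\ell(x,i)-c(x,\mathbb P))^2,\qquad c^\star(\mathbb P)=\min_{x\in\mathcal X}c(x,\mathbb P).$$ Under $\mathbb P^\infty$ the samples $\xi_1,\xi_2,\dots$ are independent with distribution $\mathbb P$, and $\hat{\mathbb P}_T(i)=\frac1T\sum_{t=1}^T \mathbf 1_{\xi_t=i}$ is the empirical distribution of the first $T$ of them ($T\ge 1$). **Regular predictors.** $\mathcal C$ is the set of sequences $\hat c=(\hat c(\cdot,\cdot,T))_{T\ge1}$ of functions $\mathcal X\times\mathcal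 P\to\mathbb R$ such that 1. $(\hat c(\cdot,\cdot,T))_{T\ge1}$ is uniformly bounded and equicontinuous on $\mathcal X\times\mathcal P$; 2. every $\hat c(x,\cdot,T)$ is differentiable (along the simplex) at every $\mathbb P\in\mathcal P^{\mathrm o}$, and the sequence of gradients $(x,\mathbb P)\mapsto\nabla\hat c(x,\cdot,T)(\mathbb P)$, $T\ge 1$, is equicontinuous on $\mathcal X\times\mathcal P^{\mathrm o}$ and uniformly bounded on $\mathcal X\times K$ for every compact $K\subset\mathcal P^{\mathrm o}$. **Prescriptors.** $\hat{\mathcal X}$ is the set of pairs $(\hat c,\hat x)$ with $\hat c\in\mathcal C$ and $\hat x=(\hat x_T)_{T\ge1}$, $\hat x_T:\mathcal P\to\mathcal X$, satisfying $\hat x_T(\mathbb P)\in\arg\min_{x\in\mathcal X}\hat c(x,\mathbb P,T)$ for all $\mathbb P\in\mathcal P$, $T\ge1$. Write $\hat c^\star(\mathbb P,T)=\hat c(\hat x_T(\mathbb P),\mathbb P,T)$. Let $(a_T)_{T\ge1}$ be nonnegative reals with $a_T\to\infty$. A pair $(\hat c,\hat x)\in\hat{\mathcal X}$ is *feasible*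 if (with $\log 0=-\infty$) $$\limsup_{T\to\infty}\frac1{a_T}\log\mathbb P^\infty\Big(c(\hat x_T(\hat{\mathbb P}_T),\mathbb P)>\hat c^\star(\hat{\mathbb P}_T,T)\Big)\le-1\qquad\forall\,\mathbb P\in\mathcal P .$$ For pairs in $\hat{\mathcal X}$ define $$(\hat c_1,\hat x_1)\preceq_{\hat{\mathcal X}}(\hat c_2,\hat x_2)\iff\forall\,\mathbb P\in\mathcal P^{\mathrm o}:\ \limsup_{T\to\infty}\frac{|\hat c_1^\star(\mathbb P,T)-c^\star(\mathbb P)|}{|\hat c_2^\star(\mathbb P,T)-c^\star(\mathbb P)|}\le1,$$ with the conventions $\frac00=1$ and $\frac u0=+\infty$ for $u>0$. A pair is *strongly optimal* if it is feasible and $\preceq_{\hat{\mathcal X}}$-preferred to every feasible pair. **Theorem (Strong optimality).** Consider the subexponential regime $a_T/T\to0$, and assume that for every $\mathbb P\in\mathcal P^{\mathrm o}$ the true cost $c(\cdot,\mathbb P)$ has a unique minimizer on $\mathcal X$. Let $$\hat c_{\mathrm V}(x,\mathbb P,T)=c(x,\mathbb P)+\sqrt{\tfrac{2a_T}{T}\,\mathrm{Var}_{\mathbb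 P}(\ell(x,\xi))}$$ be the sample variance penalization (SVP) predictor. Then $\hat c_{\mathrm V}\in\mathcal C$; there exists a prescriptor associated with it; and for every $\hat x_{\mathrm V}$ with $\hat x_{\mathrm V,T}(\mathbb P)\in\arg\min_{x\in\mathcal X}\hat c_{\mathrm V}(x,\mathbb P,T)$ for all $\mathbb P\in\mathcal P$, $T\ge1$, the pair $(\hat c_{\mathrm V},\hat x_{\mathrm V})$ is feasible and satisfies $(\hat c_{\mathrm V},\hat x_{\mathrm V})\preceq_{\hat{\mathcal X}}(\hat c,\hat x)$ for every feasible pair $(\hat c,\hat x)\in\hat{\mathcal X}$. That is, $(\hat c_{\mathrm V},\hat x_{\mathrm V})$ is strongly optimal. -/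

import Mathlib

open MeasureTheory Filter Topology

open scoped ENNReal

namespace DataDriven

/-- The probability simplex over the finite set `S` of scenarios. -/
abbrev Simplex (S : Type*) [Fintype S] : Type _ := stdSimplex ℝ S

/-- The (relative) interior of the simplex: the distributions charging every scenario. -/
def simplexInterior (S : Type*) [Fintype S] : Set (Simplex S) := {P | ∀ i, 0 < P.1 i}

/-- A predictor: one function of the decision and the distribution for each data size `T ≥ 1`. -/
abbrev Predictor (X S : Type*) [Fintype S] : Type _ := X → Simplex S → ℕ+ → ℝ

/-- Decision rules: a map from distributions to decisions for each data size `T ≥ 1`. -/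
abbrev DecisionRule (X S : Type*) [Fintype S] : Type _ := ℕ+ → Simplex S → X

section Data

variable {S : Type*} [Fintype S]

/-- A point of the simplex as a probability measure on `S`. -/
noncomputable def law [MeasurableSpace S] (P : Simplex S) : Measure S :=
  ∑ i, ENNReal.ofReal (P.1 i) • Measure.dirac i

instance isProbabilityMeasure_law [MeasurableSpace S] (P : Simplex S) :
    IsProbabilityMeasure (law P) := by
  constructor
  simp only [law, Measure.coe_finsetSum, Measure.coe_smul, Finset.sum_apply, Pi.smul_apply,
    measure_univ, smul_eq_mul, mul_one]
  rw [← ENNReal.ofReal_sum_of_nonneg (fun i _ => P.2.1 i), P.2.2, ENNReal.ofReal_one]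

/-- The law `P^∞` of an infinite sequence of independent samples with distribution `P`. -/
noncomputable def samplesLaw [MeasurableSpace S] (P : Simplex S) : Measure (ℕ → S) :=
  Measure.infinitePi (fun _ : ℕ => law P)

open Classical in
/-- The empirical distribution of the first `T` samples of the sequence `ξ`. -/
noncomputable def empirical (T : ℕ+) (ξ : ℕ → S) : Simplex S :=
  ⟨fun i => (∑ t ∈ Finset.range (T : ℕ), if ξ t = i then (1 : ℝ) else 0) / (T : ℝ), by
    have hT : ((T : ℕ) : ℝ) ≠ 0 := by exact_mod_cast T.ne_zero
    refine ⟨fun i => ?_, ?_⟩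
    · exact div_nonneg (Finset.sum_nonneg fun t _ => by split_ifs <;> norm_num) (Nat.cast_nonneg _)
    · rw [← Finset.sum_div, Finset.sum_comm]
      simp [hT]⟩

end Data

section Problem

variable {X S : Type*} [Fintype S]

/-- The expected loss `c(x, P)`. -/
def cost (ℓ : X → S → ℝ) (x : X) (P : Simplex S) : ℝ := ∑ i, P.1 i * ℓ x i

/-- The variance of the loss of `x` under `P`. -/
def lossVar (ℓ : X → S → ℝ) (x : X) (P : Simplex S) : ℝ :=
  ∑ i, P.1 i * (ℓ x i - cost ℓ x P) ^ 2

/-- The optimal true cost `c⋆(P)`. -/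
noncomputable def optCost (ℓ : X → S → ℝ) (P : Simplex S) : ℝ := ⨅ x, cost ℓ x P

/-- The sample variance penalization predictor. -/
noncomputable def svp (ℓ : X → S → ℝ) (a : ℕ+ → ℝ) : Predictor X S := fun x P T =>
  cost ℓ x P + Real.sqrt (2 * a T / (T : ℝ) * lossVar ℓ x P)

/-- `g` is the gradient at `P` of the function `f` on the simplex, normalised to be tangent to the
simplex (which makes it unique at interior points). -/
def HasSimplexGradientAt (f : Simplex S → ℝ) (g : S → ℝ) (P : Simplex S) : Prop :=
  ∑ i, g i = 0 ∧
    (fun Q : Simplex S => f Q - f P - ∑ i, g i * (Q.1 i - P.1 i)) =o[𝓝 P] fun Q => Q.1 - P.1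

/-- Regular predictors: the functions are uniformly bounded and equicontinuous on
`X × Simplex S`; they are differentiable in the distribution on the interior of the simplex, and
their gradients there are equicontinuous and bounded uniformly in the decision and the data size,
locally uniformly in the distribution (i.e. on every compact part of the interior). -/
def IsRegular [TopologicalSpace X] (c : Predictor X S) : Prop :=
  (∃ K : ℝ, ∀ x P T, |c x P T| ≤ K) ∧
  Equicontinuous (fun (T : ℕ+) (q : X × Simplex S) => c q.1 q.2 T) ∧
  ∃ G : X → Simplex S → ℕ+ → S → ℝ,
    (∀ x, ∀ P ∈ simplexInterior S, ∀ T,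
      HasSimplexGradientAt (fun Q => c x Q T) (G x P T) P) ∧
    (∀ K : Set (Simplex S), IsCompact K → K ⊆ simplexInterior S →
      ∃ M : ℝ, ∀ x, ∀ P ∈ K, ∀ T, ‖G x P T‖ ≤ M) ∧
    EquicontinuousOn (fun (T : ℕ+) (q : X × Simplex S) => G q.1 q.2 T)
      {q | q.2 ∈ simplexInterior S}

/-- A regular predictor together with an associated prescriptor: `x T P` minimizes `c (·, P, T)`. -/
def IsPrescriptorPair [TopologicalSpace X] (c : Predictor X S) (x : DecisionRule X S) : Prop :=
  IsRegular c ∧ ∀ T P y, c (x T P) P T ≤ c y P T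

/-- The predicted optimal cost `ĉ⋆(P, T)`. -/
def predOpt (c : Predictor X S) (x : DecisionRule X S) (P : Simplex S) (T : ℕ+) : ℝ :=
  c (x T P) P T

/-- The probability of disappointment of the pair at data size `T` when samples follow `P`. -/
noncomputable def disappointment [MeasurableSpace S] (ℓ : X → S → ℝ) (c : Predictor X S)
    (x : DecisionRule X S) (P : Simplex S) (T : ℕ+) : ℝ≥0∞ :=
  samplesLaw P {ξ | predOpt c x (empirical T ξ) T < cost ℓ (x T (empirical T ξ)) P}

/-- The prescription out-of-sample guarantee with speed `a` (where `log 0 = -∞`). -/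
def OutOfSampleGuarantee [MeasurableSpace S] (ℓ : X → S → ℝ) (a : ℕ+ → ℝ) (c : Predictor X S)
    (x : DecisionRule X S) : Prop :=
  ∀ P : Simplex S,
    limsup (fun T : ℕ+ => (((a T)⁻¹ : ℝ) : EReal) * ENNReal.log (disappointment ℓ c x P T)) atTop
      ≤ -1

/-- Feasibility in the optimal prescription problem. -/
def IsFeasible [TopologicalSpace X] [MeasurableSpace S] (ℓ : X → S → ℝ) (a : ℕ+ → ℝ)
    (c : Predictor X S) (x : DecisionRule X S) : Prop :=
  IsPrescriptorPair c x ∧ OutOfSampleGuarantee ℓ a c x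

open Classical in
/-- The ratio `u / v` of nonnegative numbers, with `0 / 0 = 1` and `u / 0 = ∞` for `u > 0`. -/
noncomputable def errorRatio (u v : ℝ) : ℝ≥0∞ :=
  if u = 0 ∧ v = 0 then 1 else ENNReal.ofReal u / ENNReal.ofReal v

/-- The preference order on predictor-prescriptor pairs. -/
def Preferred (ℓ : X → S → ℝ) (c₁ : Predictor X S) (x₁ : DecisionRule X S) (c₂ : Predictor X S)
    (x₂ : DecisionRule X S) : Prop :=
  ∀ P ∈ simplexInterior S,
    limsup (fun T : ℕ+ => errorRatio |predOpt c₁ x₁ P T - optCost ℓ P|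
      |predOpt c₂ x₂ P T - optCost ℓ P|) atTop ≤ 1

/-- Strong optimality: feasible, and preferred to every feasible pair. -/
def IsStronglyOptimal [TopologicalSpace X] [MeasurableSpace S] (ℓ : X → S → ℝ) (a : ℕ+ → ℝ)
    (c : Predictor X S) (x : DecisionRule X S) : Prop :=
  IsFeasible ℓ a c x ∧ ∀ c' x', IsFeasible ℓ a c' x' → Preferred ℓ c x c' x'

end Problem

end DataDriven

/-! Feasibility. By Cauchy–Schwarz, the gap between the cost of `x` under the true `P` and under the
empirical `R` is at most the chi-square-type norm of `deviation P R` times, up to a factor close to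
1, the standard deviation under `R` (`cost_sub_le_deviation`). So disappointment, whatever the
decision, forces that norm above about `√(2a/T)`. A finite net of directions reduces this event to
finitely many half-spaces, each of probability about `exp(-a)` by a Chernoff bound with the sharp
Gaussian constant (`samplesLaw_direction`). No union over decisions is needed.

Optimality. Let `x₀` be the minimizer at an interior `P` and `V` the variance of its loss. Since
`x₀` competes in the penalized problem, the error of SVP is at most `√(2a/T)·√V`
(`abs_predOpt_svp_sub_le`). Every feasible pair must asymptotically pay as much
(`eventually_excess_le_predOpt`). Suppose its predicted optimum at `P` were smaller. Feasibility at
a nearby `Q` that makes `x₀` costlier prevents underestimation there, so the predictor's derivative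
at `P` in that direction is at least about `V` (`eventually_lossVar_le_gradient`). Moving the
empirical distribution the opposite way by `ρ` then lowers the prediction by about `ρV`, whereas
every decision still costs at least the optimum under `P`. With `ρ√V` slightly below `√(2a/T)` this
causes disappointment, and a change of measure (`eventually_le_samplesLaw_tilt`) shows that it
happens with probability well above `exp(-a)`, a contradiction. Uniqueness of `x₀` enters through
`eventually_cost_le_add`. -/

namespace DataDriven

/-! ### Empirical events as finite sums over words, and a moment bound -/

section Words

variable {S : Type*} [Fintype S]

/-- The first `T` letters of a sequence. -/
def initial (T : ℕ+) (ξ : ℕ → S) : Fin T → S := fun t => ξ t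

/-- The empirical distribution of a word of length `T`. -/
noncomputable def wordEmpirical (T : ℕ+) (w : Fin T → S) : Simplex S :=
  -- The periodic extension is only a device for reusing `empirical`, which reads just the first `T`
  -- letters.
  empirical T fun n => w ⟨n % T, Nat.mod_lt _ T.pos⟩

lemma empirical_eq_wordEmpirical (T : ℕ+) (ξ : ℕ → S) :
    empirical T ξ = wordEmpirical T (initial T ξ) := by
  classical
  apply Subtype.ext
  funext i
  simp only [empirical, wordEmpirical, initial]
  congr 1
  refine Finset.sum_congr rfl fun t ht => ?_
  refine if_congr ?_ rfl rfl
  rw [Nat.mod_eq_of_lt (Finset.mem_range.1 ht)]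

lemma sum_wordEmpirical_mul (T : ℕ+) (w : Fin T → S) (f : S → ℝ) :
    (T : ℝ) * ∑ i, (wordEmpirical T w).1 i * f i = ∑ t, f (w t) := by
  classical
  have hT : ((T : ℕ) : ℝ) ≠ 0 := by exact_mod_cast T.ne_zero
  simp only [wordEmpirical, empirical, div_mul_eq_mul_div]
  rw [← Finset.sum_div, mul_div_cancel₀ _ hT]
  simp only [Finset.sum_mul]
  rw [Finset.sum_comm, Finset.sum_range]
  refine Finset.sum_congr rfl fun t _ => ?_
  simp [Nat.mod_eq_of_lt t.2]

/-- The probability of the words in `A` under independent sampling from `P`. -/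
noncomputable def wordProb (P : Simplex S) {T : ℕ+} (A : Set (Fin T → S)) : ℝ :=
  ∑ w, A.indicator (fun w => ∏ t, P.1 (w t)) w

lemma Simplex.le_one (P : Simplex S) (i : S) : P.1 i ≤ 1 := by
  rw [← P.2.2]
  exact Finset.single_le_sum (fun j _ => P.2.1 j) (Finset.mem_univ i)

lemma exp_le_quadratic {x : ℝ} (hx : |x| ≤ 1) : Real.exp x ≤ 1 + x + x ^ 2 / 2 * (1 + |x|) := by
  have h := Real.exp_bound hx (n := 3) (by norm_num)
  have h2 := (abs_le.1 h).2
  simp only [Finset.sum_range_succ, Finset.sum_range_zero] at h2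
  norm_num [Nat.factorial] at h2
  have h3 : |x| ^ 3 = x ^ 2 * |x| := by rw [pow_succ, sq_abs]
  have : 0 ≤ x ^ 2 * |x| := by positivity
  rw [h3] at h2
  nlinarith

/-- The linear term vanishes by centring, and the cubic remainder is kept as the relative error `s *
B`. The constant `1 / 2` is thus sharp as `s → 0`, as moderate deviations require. -/
lemma sum_mul_exp_le (P : Simplex S) (f : S → ℝ) {B s : ℝ} (h0 : ∑ i, P.1 i * f i = 0)
    (h1 : ∑ i, P.1 i * f i ^ 2 ≤ 1) (hB : ∀ i, |f i| ≤ B) (hs : 0 ≤ s) (hsB : s * B ≤ 1) :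
    ∑ i, P.1 i * Real.exp (s * f i) ≤ Real.exp (s ^ 2 / 2 * (1 + s * B)) := by
  have habs : ∀ i, |s * f i| ≤ s * B := fun i => by
    rw [abs_mul, abs_of_nonneg hs]
    exact mul_le_mul_of_nonneg_left (hB i) hs
  rcases isEmpty_or_nonempty S with hS | ⟨⟨i₀⟩⟩
  · simpa using (Real.exp_pos _).le
  have hB0 : 0 ≤ s * B := (abs_nonneg _).trans (habs i₀)
  calc ∑ i, P.1 i * Real.exp (s * f i)
      ≤ ∑ i, P.1 i * (1 + s * f i + (s * f i) ^ 2 / 2 * (1 + s * B)) := by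
        refine Finset.sum_le_sum fun i _ => mul_le_mul_of_nonneg_left ?_ (P.2.1 i)
        refine (exp_le_quadratic ((habs i).trans hsB)).trans ?_
        have := habs i
        gcongr
    _ = ∑ i, P.1 i + s * ∑ i, P.1 i * f i + s ^ 2 / 2 * (1 + s * B) * ∑ i, P.1 i * f i ^ 2 := by
        rw [Finset.mul_sum, Finset.mul_sum, ← Finset.sum_add_distrib, ← Finset.sum_add_distrib]
        exact Finset.sum_congr rfl fun i _ => by ring
    _ ≤ s ^ 2 / 2 * (1 + s * B) + 1 := by
        rw [h0, P.2.2]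
        nlinarith [mul_le_mul_of_nonneg_left h1 (by positivity : 0 ≤ s ^ 2 / 2 * (1 + s * B))]
    _ ≤ _ := Real.add_one_le_exp _

variable [MeasurableSpace S] [MeasurableSingletonClass S]

lemma law_singleton (P : Simplex S) (i : S) : law P {i} = ENNReal.ofReal (P.1 i) := by
  classical
  simp [law, Set.indicator_apply]

lemma samplesLaw_initial_eq (P : Simplex S) {T : ℕ+} (w : Fin T → S) :
    samplesLaw P {ξ | initial T ξ = w} = ENNReal.ofReal (∏ t, P.1 (w t)) ∧
      MeasurableSet {ξ : ℕ → S | initial T ξ = w} := by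
  -- The `Set.univ` branch is never reached on `Finset.range T`; it only makes the family total in
  -- `n`.
  have hset : {ξ : ℕ → S | initial T ξ = w} =
      ((Finset.range T : Finset ℕ) : Set ℕ).pi
        (fun n => if h : n < T then {w ⟨n, h⟩} else Set.univ) := by
    ext ξ
    simp only [initial, Set.mem_ofPred_eq, Set.mem_pi, Finset.coe_range, Set.mem_Iio, funext_iff]
    constructor
    · intro h n hn
      simpa [hn] using h ⟨n, hn⟩
    · intro h t
      simpa [t.2] using h t t.2
  have hmeas : ∀ n ∈ Finset.range T, MeasurableSet
      (if h : n < T then {w ⟨n, h⟩} else Set.univ : Set S) := by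
    intro n hn
    simp [Finset.mem_range.1 hn]
  constructor
  · rw [hset, samplesLaw, Measure.infinitePi_pi _ hmeas, Finset.prod_range,
      ENNReal.ofReal_prod_of_nonneg fun t _ => P.2.1 _]
    refine Finset.prod_congr rfl fun t _ => ?_
    simp [t.2, law_singleton]
  · rw [hset]
    exact MeasurableSet.pi (Finset.countable_toSet _) fun n hn => hmeas n hn

/-- The event is a finite disjoint union of cylinders, so `E` may be arbitrary and later estimates
become finite sums. -/
lemma samplesLaw_empirical (P : Simplex S) (T : ℕ+) (E : Set (Simplex S)) :
    samplesLaw P {ξ | empirical T ξ ∈ E} =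
      ENNReal.ofReal (wordProb P {w : Fin T → S | wordEmpirical T w ∈ E}) := by
  classical
  have hset : {ξ : ℕ → S | empirical T ξ ∈ E} =
      ⋃ w ∈ Finset.univ.filter (fun w : Fin T → S => wordEmpirical T w ∈ E),
        {ξ | initial T ξ = w} := by
    ext ξ
    simp [empirical_eq_wordEmpirical]
  rw [hset, measure_biUnion_finset]
  · simp only [(samplesLaw_initial_eq P _).1]
    rw [wordProb, ← ENNReal.ofReal_sum_of_nonneg
      fun w _ => Finset.prod_nonneg fun t _ => P.2.1 _, Finset.sum_filter]
    simp only [Set.indicator_apply, Set.mem_ofPred_eq]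
  · intro w _ w' _ hne
    refine Set.disjoint_left.2 fun ξ h h' => hne ?_
    exact h.symm.trans h'
  · exact fun w _ => (samplesLaw_initial_eq P w).2

instance isProbabilityMeasure_samplesLaw (P : Simplex S) :
    IsProbabilityMeasure (samplesLaw P) := by
  unfold samplesLaw; infer_instance

end Words

/-! ### Chernoff bounds and change of measure -/

section Deviations

variable {S : Type*} [Fintype S] [MeasurableSpace S] [MeasurableSingletonClass S]

/-- Chernoff's bound for a centred function of variance at most one, in the Gaussian regime. -/
lemma samplesLaw_chernoff (P : Simplex S) (f : S → ℝ) {B s : ℝ} (h0 : ∑ i, P.1 i * f i = 0)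
    (h1 : ∑ i, P.1 i * f i ^ 2 ≤ 1) (hB : ∀ i, |f i| ≤ B) (hs : 0 ≤ s) (hsB : s * B ≤ 1)
    (T : ℕ+) :
    samplesLaw P {ξ | s ≤ ∑ i, (empirical T ξ).1 i * f i} ≤
      ENNReal.ofReal (Real.exp (-(T * s ^ 2 * (1 - s * B) / 2))) := by
  classical
  refine (samplesLaw_empirical P T {R | s ≤ ∑ i, R.1 i * f i}).trans_le
    (ENNReal.ofReal_le_ofReal ?_)
  have hT : (0 : ℝ) < T := by exact_mod_cast T.pos
  -- Exponential Markov inequality with tilting parameter equal to the level `s`, the optimal choice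
  -- for a Gaussian of variance one.
  calc wordProb P {w : Fin T → S | wordEmpirical T w ∈ {R : Simplex S | s ≤ ∑ i, R.1 i * f i}}
      ≤ ∑ w : Fin T → S, Real.exp (-(T * s ^ 2)) * ∏ t, (P.1 (w t) * Real.exp (s * f (w t))) := by
        refine Finset.sum_le_sum fun w _ => ?_
        have hnn : 0 ≤ ∏ t, P.1 (w t) := Finset.prod_nonneg fun t _ => P.2.1 _
        rw [Finset.prod_mul_distrib, ← Real.exp_sum, ← Finset.mul_sum]
        rw [mul_left_comm, ← Real.exp_add]
        refine Set.indicator_apply_le' (fun hw => le_mul_of_one_le_right hnn ?_)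
          fun _ => mul_nonneg hnn (Real.exp_pos _).le
        have hw' : s ≤ ∑ i, (wordEmpirical T w).1 i * f i := hw
        rw [Real.one_le_exp_iff, ← sum_wordEmpirical_mul T w f]
        nlinarith [mul_le_mul_of_nonneg_left hw' (mul_nonneg hs hT.le)]
    _ = Real.exp (-(T * s ^ 2)) * (∑ i, P.1 i * Real.exp (s * f i)) ^ (T : ℕ) := by
        rw [← Finset.mul_sum, Fintype.sum_pow]
    _ ≤ Real.exp (-(T * s ^ 2)) * Real.exp (s ^ 2 / 2 * (1 + s * B)) ^ (T : ℕ) := by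
        gcongr
        · exact Finset.sum_nonneg fun i _ => mul_nonneg (P.2.1 i) (Real.exp_pos _).le
        · exact sum_mul_exp_le P f h0 h1 hB hs hsB
    _ = _ := by
        rw [← Real.exp_nat_mul, ← Real.exp_add]
        congr 1
        ring

/-- Change of measure for events of the empirical distribution. -/
lemma samplesLaw_change_of_measure (P Q : Simplex S) (hP : P ∈ simplexInterior S)
    (hQ : Q ∈ simplexInterior S) (T : ℕ+) (E : Set (Simplex S)) {L : ℝ}
    (hL : ∀ R ∈ E, ∑ i, R.1 i * Real.log (Q.1 i / P.1 i) ≤ L) :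
    ENNReal.ofReal (Real.exp (-(T * L))) * samplesLaw Q {ξ | empirical T ξ ∈ E} ≤
      samplesLaw P {ξ | empirical T ξ ∈ E} := by
  classical
  rw [samplesLaw_empirical, samplesLaw_empirical, ← ENNReal.ofReal_mul (Real.exp_pos _).le]
  refine ENNReal.ofReal_le_ofReal ?_
  rw [wordProb, wordProb, Finset.mul_sum]
  refine Finset.sum_le_sum fun w _ => ?_
  by_cases hw : wordEmpirical T w ∈ E
  · have hT : (0 : ℝ) < T := by exact_mod_cast T.pos
    simp only [Set.indicator_apply, Set.mem_ofPred_eq, hw, if_true]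
    -- The log-likelihood ratio of a word is `T` times a linear functional of its empirical
    -- distribution.
    have h1 : ∑ t, Real.log (Q.1 (w t) / P.1 (w t)) ≤ T * L := by
      rw [← sum_wordEmpirical_mul T w fun i => Real.log (Q.1 i / P.1 i)]
      exact mul_le_mul_of_nonneg_left (hL _ hw) hT.le
    have h2 : ∏ t, Q.1 (w t) = Real.exp (∑ t, Real.log (Q.1 (w t) / P.1 (w t))) *
        ∏ t, P.1 (w t) := by
      rw [Real.exp_sum, ← Finset.prod_mul_distrib]
      refine Finset.prod_congr rfl fun t _ => ?_
      rw [Real.exp_log (div_pos (hQ _) (hP _)), div_mul_cancel₀ _ (hP _).ne']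
    rw [h2, ← mul_assoc, ← Real.exp_add]
    refine mul_le_of_le_one_left (Finset.prod_nonneg fun t _ => P.2.1 _) ?_
    rw [Real.exp_le_one_iff]
    linarith
  · simp [hw]

lemma samplesLaw_support (P : Simplex S) (T : ℕ+) :
    samplesLaw P {ξ | ∃ i, P.1 i = 0 ∧ (empirical T ξ).1 i ≠ 0} = 0 := by
  classical
  refine (samplesLaw_empirical P T {R | ∃ i, P.1 i = 0 ∧ R.1 i ≠ 0}).trans ?_
  rw [ENNReal.ofReal_eq_zero]
  refine (Finset.sum_eq_zero fun w _ => ?_).le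
  refine Set.indicator_apply_eq_zero.2 ?_
  rintro ⟨i, hi, hne⟩
  have h := sum_wordEmpirical_mul T w (fun j => if j = i then 1 else 0)
  simp only [mul_ite, mul_one, mul_zero, Finset.sum_ite_eq', Finset.mem_univ, if_true] at h
  have hT : (T : ℝ) ≠ 0 := by exact_mod_cast T.ne_zero
  have h2 : ∑ t, (if w t = i then (1 : ℝ) else 0) ≠ 0 := h ▸ mul_ne_zero hT hne
  obtain ⟨t, -, ht⟩ := Finset.exists_ne_zero_of_sum_ne_zero h2
  have : w t = i := by by_contra hc; simp [hc] at ht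
  exact Finset.prod_eq_zero (Finset.mem_univ t) (by rw [this, hi])

/-- Chernoff for the centred indicators of each letter, with both signs: these are bounded by one,
and `s ≤ 1 / 2` leaves at least half of the Gaussian exponent. -/
lemma samplesLaw_concentration (P : Simplex S) (T : ℕ+) {s : ℝ} (hs : 0 ≤ s) (hs2 : s ≤ 1 / 2) :
    samplesLaw P {ξ | ∃ i, s ≤ |(empirical T ξ).1 i - P.1 i|} ≤
      ENNReal.ofReal (2 * Fintype.card S * Real.exp (-(T * s ^ 2 / 4))) := by
  classical
  have hT : (0 : ℝ) < T := by exact_mod_cast T.pos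
  have key : ∀ (i : S) (σ : ℝ), |σ| = 1 →
      samplesLaw P {ξ | s ≤ σ * ((empirical T ξ).1 i - P.1 i)} ≤
        ENNReal.ofReal (Real.exp (-(T * s ^ 2 / 4))) := by
    intro i σ hσ
    set f : S → ℝ := fun j => σ * ((if j = i then 1 else 0) - P.1 i) with hf
    have hlin : ∀ R : Simplex S, ∑ j, R.1 j * f j = σ * (R.1 i - P.1 i) := by
      intro R
      simp only [hf]
      calc _ = σ * (∑ j, R.1 j * (if j = i then 1 else 0) - (∑ j, R.1 j) * P.1 i) := by
            rw [Finset.sum_mul, ← Finset.sum_sub_distrib, Finset.mul_sum]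
            exact Finset.sum_congr rfl fun j _ => by ring
        _ = _ := by rw [R.2.2]; simp
    have hf1 : ∀ j, |f j| ≤ 1 := by
      intro j
      rw [hf, abs_mul, hσ, one_mul, abs_le]
      have := P.2.1 i
      have := Simplex.le_one P i
      split_ifs <;> constructor <;> linarith
    have h2 : ∑ j, P.1 j * f j ^ 2 ≤ 1 := by
      rw [← P.2.2]
      refine Finset.sum_le_sum fun j _ => mul_le_of_le_one_right (P.2.1 j) ?_
      rw [← sq_abs]
      exact pow_le_one₀ (abs_nonneg _) (hf1 j)
    have h := samplesLaw_chernoff P f (B := 1) (by rw [hlin]; simp) h2 hf1 hs (by linarith) T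
    simp only [hlin] at h
    refine h.trans (ENNReal.ofReal_le_ofReal (Real.exp_le_exp.2 ?_))
    have : 0 ≤ T * s ^ 2 := by positivity
    nlinarith
  have hsub : {ξ | ∃ i, s ≤ |(empirical T ξ).1 i - P.1 i|} ⊆
      ⋃ i ∈ (Finset.univ : Finset S), ({ξ | s ≤ 1 * ((empirical T ξ).1 i - P.1 i)} ∪
        {ξ | s ≤ (-1) * ((empirical T ξ).1 i - P.1 i)}) := by
    rintro ξ ⟨i, hi⟩
    simp only [Set.mem_iUnion]
    refine ⟨i, Finset.mem_univ i, ?_⟩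
    rcases le_abs.1 hi with h | h
    · left; simpa using h
    · right; simpa using h
  refine (measure_mono hsub).trans ((measure_biUnion_finset_le _ _).trans ?_)
  refine (Finset.sum_le_sum fun i _ => (measure_union_le _ _).trans
    (add_le_add (key i 1 (by simp)) (key i (-1) (by simp)))).trans ?_
  rw [← ENNReal.ofReal_add (Real.exp_pos _).le (Real.exp_pos _).le, Finset.sum_const,
    Finset.card_univ, nsmul_eq_mul, ← ENNReal.ofReal_natCast,
    ← ENNReal.ofReal_mul (Nat.cast_nonneg _)]
  refine ENNReal.ofReal_le_ofReal (le_of_eq ?_)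
  ring

end Deviations

/-! ### Equicontinuity of affine families -/

section Equicontinuity

/-- A family `u + b T • v` with `u`, `v` continuous and `b` bounded is equicontinuous. -/
lemma equicontinuousOn_add_smul {ι Y E : Type*} [TopologicalSpace Y] [NormedAddCommGroup E]
    [NormedSpace ℝ E] {s : Set Y} {u v : Y → E} (hu : ContinuousOn u s) (hv : ContinuousOn v s)
    {b : ι → ℝ} {B : ℝ} (hb : ∀ t, |b t| ≤ B) :
    EquicontinuousOn (fun t y => u y + b t • v y) s := by
  intro y hy U hU
  obtain ⟨ε, hε, hεU⟩ := Metric.mem_uniformity_dist.1 hU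
  have hB : 0 < |B| + 1 := by positivity
  filter_upwards [Metric.continuousWithinAt_iff'.1 (hu y hy) (ε / 2) (by positivity),
    Metric.continuousWithinAt_iff'.1 (hv y hy) (ε / 2 / (|B| + 1)) (by positivity)] with z h1 h2 t
  refine hεU ?_
  rw [dist_comm, dist_eq_norm] at h1 h2
  rw [dist_eq_norm]
  have e : u y + b t • v y - (u z + b t • v z) = (u y - u z) + b t • (v y - v z) := by
    rw [smul_sub]; abel
  rw [e]
  calc _ ≤ ‖u y - u z‖ + |b t| * ‖v y - v z‖ := by
        refine (norm_add_le _ _).trans ?_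
        rw [norm_smul, Real.norm_eq_abs]
    _ ≤ ‖u y - u z‖ + (|B| + 1) * ‖v y - v z‖ := by
        have := (hb t).trans ((le_abs_self B).trans (le_add_of_nonneg_right zero_le_one))
        gcongr
    _ < ε / 2 + ε / 2 := by
        have := (lt_div_iff₀' hB).1 h2
        linarith
    _ = ε := by ring

end Equicontinuity

/-! ### Gradients along the simplex -/

section Gradient

variable {S : Type*} [Fintype S]

/-- The projection of a vector onto the tangent space of the simplex. -/
noncomputable def tangent (g : S → ℝ) : S → ℝ := fun i => g i - (∑ j, g j) / Fintype.card S

lemma sum_tangent (g : S → ℝ) : ∑ i, tangent g i = 0 := by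
  rcases isEmpty_or_nonempty S with hS | hS
  · simp
  · have : (Fintype.card S : ℝ) ≠ 0 := by exact_mod_cast Fintype.card_ne_zero
    simp [tangent, Finset.sum_sub_distrib, mul_div_cancel₀ _ this]

lemma Simplex.sum_sub (P Q : Simplex S) : ∑ i, (Q.1 i - P.1 i) = 0 := by
  rw [Finset.sum_sub_distrib, P.2.2, Q.2.2, sub_self]

lemma sum_tangent_mul (g : S → ℝ) {v : S → ℝ} (hv : ∑ i, v i = 0) :
    ∑ i, tangent g i * v i = ∑ i, g i * v i := by
  simp only [tangent, sub_mul, Finset.sum_sub_distrib]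
  rw [← Finset.mul_sum, hv, mul_zero, sub_zero]

lemma continuous_tangent : Continuous (tangent : (S → ℝ) → S → ℝ) := by
  unfold tangent; fun_prop

lemma tangent_add_smul (g h : S → ℝ) (b : ℝ) :
    tangent (fun i => g i + b * h i) = tangent g + b • tangent h := by
  funext i
  simp only [tangent, Finset.sum_add_distrib, ← Finset.mul_sum, Pi.add_apply, Pi.smul_apply,
    smul_eq_mul]
  ring

/-- The linear functional with given coefficients. -/
noncomputable def linearForm (k : S → ℝ) : (S → ℝ) →L[ℝ] ℝ :=
  ∑ i, k i • ContinuousLinearMap.proj i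

lemma linearForm_apply (k v : S → ℝ) : linearForm k v = ∑ i, k i * v i := by
  simp [linearForm]

/-- Differences of points of the simplex have zero sum, so projecting the coefficients does not
change the pairing. -/
lemma HasFDerivAt.hasSimplexGradientAt {F : (S → ℝ) → ℝ} {L : (S → ℝ) →L[ℝ] ℝ} {P : Simplex S}
    (hF : HasFDerivAt F L P.1) {f : Simplex S → ℝ} (hf : ∀ Q, f Q = F Q.1) {g : S → ℝ}
    (hg : ∀ v, L v = ∑ i, g i * v i) : HasSimplexGradientAt f (tangent g) P := by
  refine ⟨sum_tangent g, ?_⟩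
  have h := hF.isLittleO.comp_tendsto (continuous_subtype_val.tendsto P)
  refine h.congr_left fun Q => ?_
  simp only [Function.comp_apply, hf, hg, Pi.sub_apply]
  rw [sum_tangent_mul _ (Simplex.sum_sub P Q)]

end Gradient

/-! ### Regularity of the SVP predictor -/

section SVP

variable {X S : Type*} [Fintype S]

lemma lossVar_nonneg (ℓ : X → S → ℝ) (x : X) (P : Simplex S) : 0 ≤ lossVar ℓ x P :=
  Finset.sum_nonneg fun i _ => mul_nonneg (P.2.1 i) (sq_nonneg _)

lemma cost_sub (ℓ : X → S → ℝ) (x : X) (P : Simplex S) (m : ℝ) :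
    ∑ i, P.1 i * (ℓ x i - m) = cost ℓ x P - m := by
  simp only [mul_sub, Finset.sum_sub_distrib, ← Finset.sum_mul, P.2.2, one_mul, cost]

/-- Freezing `m` at the cost at a base point makes the variance a linear form minus the square of an
affine one that vanishes there, so the square does not contribute to the derivative. -/
lemma lossVar_eq (ℓ : X → S → ℝ) (x : X) (P : Simplex S) (m : ℝ) :
    lossVar ℓ x P = ∑ i, P.1 i * (ℓ x i - m) ^ 2 - (cost ℓ x P - m) ^ 2 := by
  have h := cost_sub ℓ x P m
  have e : lossVar ℓ x P = ∑ i, P.1 i * (ℓ x i - m) ^ 2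
      - 2 * (cost ℓ x P - m) * ∑ i, P.1 i * (ℓ x i - m) + (cost ℓ x P - m) ^ 2 * ∑ i, P.1 i := by
    rw [lossVar, Finset.mul_sum, Finset.mul_sum, ← Finset.sum_sub_distrib,
      ← Finset.sum_add_distrib]
    exact Finset.sum_congr rfl fun i _ => by ring
  rw [e, h, P.2.2]
  ring

lemma mul_sq_le_lossVar (ℓ : X → S → ℝ) (x : X) (P : Simplex S) (i : S) :
    P.1 i * (ℓ x i - cost ℓ x P) ^ 2 ≤ lossVar ℓ x P :=
  Finset.single_le_sum (f := fun i => P.1 i * (ℓ x i - cost ℓ x P) ^ 2)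
    (fun j _ => mul_nonneg (P.2.1 j) (sq_nonneg _)) (Finset.mem_univ i)

lemma loss_eq_cost_of_lossVar_eq_zero {ℓ : X → S → ℝ} {x : X} {P : Simplex S}
    (hP : P ∈ simplexInterior S) (h : lossVar ℓ x P = 0) (i : S) : ℓ x i = cost ℓ x P := by
  have h1 := mul_sq_le_lossVar ℓ x P i
  rw [h] at h1
  have h2 := hP i
  have h3 : (ℓ x i - cost ℓ x P) ^ 2 ≤ 0 := by
    by_contra hc
    have := mul_pos h2 (not_le.1 hc)
    linarith
  have := pow_eq_zero_iff two_ne_zero |>.1 (le_antisymm h3 (sq_nonneg _))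
  linarith

/-- The derivative of the standard deviation in the distribution. -/
noncomputable def devGrad (ℓ : X → S → ℝ) (x : X) (P : Simplex S) : S → ℝ := fun i =>
  (ℓ x i - cost ℓ x P) ^ 2 / (2 * √(lossVar ℓ x P))

lemma devGrad_nonneg (ℓ : X → S → ℝ) (x : X) (P : Simplex S) (i : S) : 0 ≤ devGrad ℓ x P i := by
  unfold devGrad; positivity

lemma devGrad_le {ℓ : X → S → ℝ} {x : X} {P : Simplex S} (hP : P ∈ simplexInterior S) (i : S) :
    devGrad ℓ x P i ≤ √(lossVar ℓ x P) / (2 * P.1 i) := by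
  have hPi := hP i
  have h := mul_sq_le_lossVar ℓ x P i
  rcases (lossVar_nonneg ℓ x P).eq_or_lt with h0 | h0
  · simp [devGrad, ← h0]
  · have hs : 0 < √(lossVar ℓ x P) := Real.sqrt_pos.2 h0
    rw [devGrad, div_le_div_iff₀ (by positivity) (by positivity)]
    have := Real.mul_self_sqrt h0.le
    nlinarith

lemma svp_eq (ℓ : X → S → ℝ) {a : ℕ+ → ℝ} (ha : ∀ T, 0 ≤ a T) (x : X) (P : Simplex S) (T : ℕ+) :
    svp ℓ a x P T = cost ℓ x P + √(2 * a T / T) * √(lossVar ℓ x P) := by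
  have : 0 ≤ 2 * a T / (T : ℝ) := div_nonneg (mul_nonneg two_pos.le (ha T)) (Nat.cast_nonneg _)
  rw [svp, Real.sqrt_mul this]

/-- The square root is only singular at zero variance. At an interior point this forces the loss to
be constant, so the penalty vanishes on the whole simplex, in agreement with the value 0 that
division by zero gives to `devGrad`. -/
lemma hasSimplexGradientAt_svp (ℓ : X → S → ℝ) {a : ℕ+ → ℝ} (ha : ∀ T, 0 ≤ a T) (x : X)
    {P : Simplex S} (hP : P ∈ simplexInterior S) (T : ℕ+) :
    HasSimplexGradientAt (fun Q => svp ℓ a x Q T)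
      (tangent fun i => ℓ x i + √(2 * a T / T) * devGrad ℓ x P i) P := by
  set b := √(2 * a T / T)
  set c := cost ℓ x P with hc
  rcases (lossVar_nonneg ℓ x P).eq_or_lt with h0 | h0
  · refine HasFDerivAt.hasSimplexGradientAt (linearForm (ℓ x)).hasFDerivAt (fun Q => ?_)
      fun v => ?_
    · have hv : lossVar ℓ x Q = 0 := by
        have h1 := loss_eq_cost_of_lossVar_eq_zero hP h0.symm
        rw [lossVar_eq ℓ x Q c]
        simp only [h1, ← hc, sub_self]
        have := cost_sub ℓ x Q c
        simp only [h1, ← hc, sub_self, mul_zero, Finset.sum_const_zero] at this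
        simp [← this]
      rw [svp_eq ℓ ha, hv, linearForm_apply]
      simp [cost, mul_comm]
    · simp [linearForm_apply, devGrad, ← h0]
  · set k : S → ℝ := fun i => ℓ x i - c with hk
    have hval : linearForm (fun i => k i ^ 2) P.1 - linearForm k P.1 ^ 2 = lossVar ℓ x P := by
      rw [lossVar_eq ℓ x P c, ← cost_sub]
      simp [linearForm_apply, hk, mul_comm]
    have hzero : linearForm k P.1 = 0 := by
      have := cost_sub ℓ x P c
      rw [← hc, sub_self] at this
      rw [← this, linearForm_apply]
      simp [hk, mul_comm]
    have h1 : HasFDerivAt (fun v => linearForm (fun i => k i ^ 2) v - linearForm k v ^ 2)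
        (linearForm fun i => k i ^ 2) P.1 := by
      refine (((linearForm fun i => k i ^ 2).hasFDerivAt (x := P.1)).sub
        ((linearForm k).hasFDerivAt.pow 2)).congr_fderiv ?_
      simp [hzero]
    have h2 : HasFDerivAt (fun v => linearForm (ℓ x) v +
        b * √(linearForm (fun i => k i ^ 2) v - linearForm k v ^ 2))
        (linearForm (ℓ x) + b • (1 / (2 * √(lossVar ℓ x P))) • linearForm fun i => k i ^ 2)
        P.1 := by
      rw [← hval]
      exact (linearForm (ℓ x)).hasFDerivAt.add ((h1.sqrt (by rw [hval]; exact h0.ne')).const_mul b)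
    refine HasFDerivAt.hasSimplexGradientAt h2 (fun Q => ?_) fun v => ?_
    · rw [svp_eq ℓ ha, lossVar_eq ℓ x Q c, ← cost_sub]
      simp only [linearForm_apply, hk, mul_comm (Q.1 _), cost, b]
    · simp only [add_apply, smul_apply, linearForm_apply, smul_eq_mul, devGrad, Finset.mul_sum,
        ← Finset.sum_add_distrib]
      exact Finset.sum_congr rfl fun i _ => by simp only [hk, hc]; ring

variable [TopologicalSpace X]

lemma continuous_cost {ℓ : X → S → ℝ} (hℓ : ∀ i, Continuous fun x => ℓ x i) :
    Continuous fun q : X × Simplex S => cost ℓ q.1 q.2 := by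
  unfold cost
  refine continuous_finsetSum _ fun i _ => Continuous.mul ?_ ((hℓ i).comp continuous_fst)
  exact (continuous_apply i).comp (continuous_subtype_val.comp continuous_snd)

lemma continuous_lossVar {ℓ : X → S → ℝ} (hℓ : ∀ i, Continuous fun x => ℓ x i) :
    Continuous fun q : X × Simplex S => lossVar ℓ q.1 q.2 := by
  unfold lossVar
  refine continuous_finsetSum _ fun i _ => Continuous.mul ?_ ?_
  · exact (continuous_apply i).comp (continuous_subtype_val.comp continuous_snd)
  · exact (((hℓ i).comp continuous_fst).sub (continuous_cost hℓ)).pow 2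

/-- At points of zero variance, `devGrad_le` squeezes the quotient below a multiple of the standard
deviation; elsewhere it is a quotient of continuous functions. -/
lemma continuousOn_devGrad {ℓ : X → S → ℝ} (hℓ : ∀ i, Continuous fun x => ℓ x i) :
    ContinuousOn (fun q : X × Simplex S => devGrad ℓ q.1 q.2) {q | q.2 ∈ simplexInterior S} := by
  rintro ⟨x, P⟩ hP
  have hP' : P ∈ simplexInterior S := hP
  rw [continuousWithinAt_pi]
  intro i
  have hsq := (continuous_lossVar hℓ).sqrt
  have hcoord : Continuous fun q : X × Simplex S => q.2.1 i :=
    (continuous_apply i).comp (continuous_subtype_val.comp continuous_snd)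
  rcases (lossVar_nonneg ℓ x P).eq_or_lt with h0 | h0
  · have hval : devGrad ℓ x P i = 0 := by simp [devGrad, ← h0]
    have hlim : Tendsto (fun q : X × Simplex S => √(lossVar ℓ q.1 q.2) / (2 * q.2.1 i))
        (𝓝[{q | q.2 ∈ simplexInterior S}] (x, P)) (𝓝 0) := by
      have h := (hsq.continuousAt (x := (x, P))).div (hcoord.const_mul 2).continuousAt
        (by have := hP' i; positivity)
      have h' := h.tendsto.mono_left
        (nhdsWithin_le_nhds (s := {q : X × Simplex S | q.2 ∈ simplexInterior S}))
      simpa only [Pi.div_def, ← h0, Real.sqrt_zero, zero_div] using h'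
    unfold ContinuousWithinAt
    simp only [hval]
    refine squeeze_zero' (Eventually.of_forall fun q => devGrad_nonneg ℓ q.1 q.2 i) ?_ hlim
    filter_upwards [self_mem_nhdsWithin] with q hq using devGrad_le hq i
  · refine ContinuousAt.continuousWithinAt ?_
    refine ContinuousAt.div ?_ (hsq.const_mul 2).continuousAt ?_
    · exact ((((hℓ i).comp continuous_fst).sub (continuous_cost hℓ)).pow 2).continuousAt
    · have := Real.sqrt_pos.2 h0
      positivity

lemma exists_bound_of_tendsto_zero {b : ℕ+ → ℝ} (hb : Tendsto b atTop (𝓝 0)) :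
    ∃ B, ∀ T, |b T| ≤ B := by
  obtain ⟨N, hN⟩ := eventually_atTop.1
    (hb.abs.eventually (gt_mem_nhds (by norm_num : |(0 : ℝ)| < 1)))
  obtain ⟨C, hC⟩ := ((Set.finite_Iic N).image fun T => |b T|).bddAbove
  refine ⟨max C 1, fun T => ?_⟩
  rcases le_total T N with h | h
  · exact (hC ⟨T, h, rfl⟩).trans (le_max_left _ _)
  · exact (hN T h).le.trans (le_max_right _ _)

lemma tendsto_sqrt_speed {a : ℕ+ → ℝ} (ha : Tendsto (fun T : ℕ+ => a T / (T : ℝ)) atTop (𝓝 0))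
    (c : ℝ) : Tendsto (fun T : ℕ+ => √(c * a T / T)) atTop (𝓝 0) := by
  have h := (ha.const_mul c).sqrt
  simpa [mul_div_assoc] using h

lemma isRegular_svp [CompactSpace X] {ℓ : X → S → ℝ} (hℓ : ∀ i, Continuous fun x => ℓ x i)
    {a : ℕ+ → ℝ} (ha : ∀ T, 0 ≤ a T)
    (ha_sub : Tendsto (fun T : ℕ+ => a T / (T : ℝ)) atTop (𝓝 0)) : IsRegular (svp ℓ a) := by
  obtain ⟨B, hB⟩ := exists_bound_of_tendsto_zero (tendsto_sqrt_speed ha_sub 2)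
  have hsq := (continuous_lossVar hℓ).sqrt
  have hdev := continuousOn_devGrad hℓ
  have htan : Continuous fun q : X × Simplex S => tangent (ℓ q.1) :=
    continuous_tangent.comp ((continuous_pi hℓ).comp continuous_fst)
  have hdev' : ContinuousOn (fun q : X × Simplex S => tangent (devGrad ℓ q.1 q.2))
      {q | q.2 ∈ simplexInterior S} := continuous_tangent.comp_continuousOn hdev
  refine ⟨?_, ?_, fun x P T => tangent fun i => ℓ x i + √(2 * a T / T) * devGrad ℓ x P i,
    fun x P hP T => hasSimplexGradientAt_svp ℓ ha x hP T, fun K hK hKi => ?_, ?_⟩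
  · obtain ⟨C, hC⟩ := isCompact_univ.exists_bound_of_continuousOn (continuous_cost hℓ).continuousOn
    obtain ⟨D, hD⟩ := isCompact_univ.exists_bound_of_continuousOn hsq.continuousOn
    refine ⟨C + B * D, fun x P T => ?_⟩
    have h1 := hC (x, P) (Set.mem_univ _)
    have h2 := hD (x, P) (Set.mem_univ _)
    rw [Real.norm_eq_abs] at h1 h2
    rw [svp_eq ℓ ha]
    refine (abs_add_le _ _).trans (add_le_add h1 ?_)
    rw [abs_mul]
    exact mul_le_mul (hB T) h2 (abs_nonneg _) ((abs_nonneg _).trans (hB T))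
  · rw [← equicontinuousOn_univ]
    have := equicontinuousOn_add_smul (continuous_cost hℓ).continuousOn
      (hsq.continuousOn (s := Set.univ)) hB
    simpa only [svp_eq ℓ ha, smul_eq_mul] using this
  · have hKc : IsCompact ((Set.univ : Set X) ×ˢ K) := isCompact_univ.prod hK
    obtain ⟨C, hC⟩ := hKc.exists_bound_of_continuousOn htan.continuousOn
    obtain ⟨D, hD⟩ := hKc.exists_bound_of_continuousOn (hdev'.mono fun q hq => hKi hq.2)
    refine ⟨C + B * D, fun x P hP T => ?_⟩
    have h1 := hC (x, P) ⟨Set.mem_univ _, hP⟩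
    have h2 := hD (x, P) ⟨Set.mem_univ _, hP⟩
    simp only [tangent_add_smul]
    refine (norm_add_le _ _).trans (add_le_add h1 ?_)
    rw [norm_smul]
    exact mul_le_mul (hB T) h2 (norm_nonneg _) ((abs_nonneg _).trans (hB T))
  · simp only [tangent_add_smul]
    exact equicontinuousOn_add_smul htan.continuousOn hdev' hB

lemma exists_isPrescriptorPair_svp [CompactSpace X] [Nonempty X] {ℓ : X → S → ℝ}
    (hℓ : ∀ i, Continuous fun x => ℓ x i) {a : ℕ+ → ℝ} (ha : ∀ T, 0 ≤ a T)
    (ha_sub : Tendsto (fun T : ℕ+ => a T / (T : ℝ)) atTop (𝓝 0)) :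
    ∃ xV : DecisionRule X S, IsPrescriptorPair (svp ℓ a) xV := by
  have hcont : ∀ T P, Continuous fun x => svp ℓ a x P T := fun T P => by
    have hi : Continuous fun x : X => (x, P) := by fun_prop
    exact ((continuous_cost hℓ).comp hi).add
      (((continuous_lossVar hℓ).comp hi).const_mul _).sqrt
  have h : ∀ T P, ∃ x, ∀ y, svp ℓ a x P T ≤ svp ℓ a y P T := fun T P => by
    obtain ⟨x, -, hx⟩ := isCompact_univ.exists_isMinOn Set.univ_nonempty (hcont T P).continuousOn
    exact ⟨x, fun y => hx (Set.mem_univ y)⟩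
  choose xV hxV using h
  exact ⟨xV, isRegular_svp hℓ ha ha_sub, hxV⟩

end SVP

/-! ### Passing between the limsup guarantee and exponential bounds -/

section Speed

variable {a : ℕ+ → ℝ} {p : ℕ+ → ℝ≥0∞}

lemma EReal.coe_neg_one : ((-1 : ℝ) : EReal) = -1 := by
  rw [EReal.coe_neg, EReal.coe_one]

lemma log_ofReal_exp (x : ℝ) : ENNReal.log (ENNReal.ofReal (Real.exp x)) = (x : EReal) := by
  rw [ENNReal.log_ofReal_of_pos (Real.exp_pos x), Real.log_exp]

lemma inv_mul_coe_neg_mul {α : ℝ} (hα : 0 < α) (κ : ℝ) :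
    ((α⁻¹ : ℝ) : EReal) * ((-(κ * α) : ℝ) : EReal) = ((-κ : ℝ) : EReal) := by
  rw [← EReal.coe_mul]
  congr 1
  field_simp

lemma limsup_log_le_neg_one (ha_top : Tendsto a atTop atTop)
    (h : ∀ κ, 0 ≤ κ → κ < 1 → ∀ᶠ T in atTop, p T ≤ ENNReal.ofReal (Real.exp (-(κ * a T)))) :
    limsup (fun T : ℕ+ => (((a T)⁻¹ : ℝ) : EReal) * ENNReal.log (p T)) atTop ≤ -1 := by
  refine EReal.le_of_forall_lt_iff_le.1 fun z hz => ?_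
  have hz' : -1 < z := EReal.coe_lt_coe_iff.1 (EReal.coe_neg_one ▸ hz)
  -- The level `z` may be positive; clamping keeps the rate nonnegative and still gives `-κ ≤ z`.
  have hκ : ((-(max (-z) 0) : ℝ) : EReal) ≤ z := by
    have := le_max_left (-z) 0
    exact_mod_cast (by linarith : -(max (-z) 0) ≤ z)
  refine (limsup_le_of_le (by isBoundedDefault) ?_).trans hκ
  filter_upwards [h (max (-z) 0) (le_max_right _ _) (max_lt (by linarith) one_pos),
    ha_top.eventually_gt_atTop 0] with T hT hpos
  rw [← inv_mul_coe_neg_mul hpos, ← log_ofReal_exp (-(_ * a T))]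
  exact mul_le_mul_of_nonneg_left (ENNReal.log_le_log hT)
    (by exact_mod_cast (inv_pos.2 hpos).le)

lemma eventually_le_exp_of_limsup (ha_top : Tendsto a atTop atTop)
    (h : limsup (fun T : ℕ+ => (((a T)⁻¹ : ℝ) : EReal) * ENNReal.log (p T)) atTop ≤ -1)
    {κ : ℝ} (hκ : κ < 1) :
    ∀ᶠ T in atTop, p T ≤ ENNReal.ofReal (Real.exp (-(κ * a T))) := by
  have hlt : limsup (fun T : ℕ+ => (((a T)⁻¹ : ℝ) : EReal) * ENNReal.log (p T)) atTop
      < ((-κ : ℝ) : EReal) :=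
    h.trans_lt (EReal.coe_neg_one ▸ EReal.coe_lt_coe_iff.2 (neg_lt_neg hκ))
  filter_upwards [eventually_lt_of_limsup_lt hlt, ha_top.eventually_gt_atTop 0] with T hT hpos
  by_contra hc
  refine hT.not_ge ?_
  rw [← inv_mul_coe_neg_mul hpos, ← log_ofReal_exp (-(κ * a T))]
  exact mul_le_mul_of_nonneg_left (ENNReal.log_le_log (not_le.1 hc).le)
    (by exact_mod_cast (inv_pos.2 hpos).le)

end Speed

/-! ### Out-of-sample guarantee for SVP -/

section Feasibility

variable {X S : Type*} [Fintype S]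

/-- Finitely many directions almost attain the norm of every vector. -/
lemma exists_finset_almost_norming {ε : ℝ} (hε : 0 < ε) :
    ∃ N : Finset (S → ℝ), (∀ v ∈ N, ∑ i, v i ^ 2 ≤ 1) ∧
      ∀ w : S → ℝ, 0 < √(∑ i, w i ^ 2) → ∃ v ∈ N, (1 - ε) * √(∑ i, w i ^ 2) ≤ ∑ i, v i * w i := by
  classical
  obtain ⟨t, hts, htf, hcov⟩ :=
    (isCompact_sphere (0 : EuclideanSpace ℝ S) 1).finite_cover_balls hε
  refine ⟨htf.toFinset.image fun v i => v i, ?_, ?_⟩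
  · intro v hv
    obtain ⟨v', hv', rfl⟩ := Finset.mem_image.1 hv
    have h := hts (htf.mem_toFinset.1 hv')
    rw [mem_sphere_zero_iff_norm, EuclideanSpace.norm_eq] at h
    have := Real.sqrt_eq_one.1 h
    simpa using this.le
  · intro w hw
    set W : EuclideanSpace ℝ S := WithLp.toLp 2 w with hW
    have hnorm : ‖W‖ = √(∑ i, w i ^ 2) := by
      rw [EuclideanSpace.norm_eq]; simp [hW]
    rw [← hnorm] at hw ⊢
    have hu : ‖W‖⁻¹ • W ∈ Metric.sphere (0 : EuclideanSpace ℝ S) 1 := by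
      rw [mem_sphere_zero_iff_norm, norm_smul, norm_inv, norm_norm, inv_mul_cancel₀ hw.ne']
    obtain ⟨v, hv, hd⟩ := Set.mem_iUnion₂.1 (hcov hu)
    have hv1 : ‖v‖ = 1 := mem_sphere_zero_iff_norm.1 (hts hv)
    refine ⟨fun i => v i, Finset.mem_image.2 ⟨v, htf.mem_toFinset.2 hv, rfl⟩, ?_⟩
    have hin : inner ℝ v W = ∑ i, v i * w i := by
      simp [PiLp.inner_apply, hW, mul_comm]
    rw [← hin]
    have h1 : inner ℝ v (‖W‖⁻¹ • W) = 1 + inner ℝ v (‖W‖⁻¹ • W - v) := by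
      rw [inner_sub_right, real_inner_self_eq_norm_sq, hv1]; ring
    have h2 := abs_real_inner_le_norm v (‖W‖⁻¹ • W - v)
    rw [hv1, one_mul, ← dist_eq_norm] at h2
    have h3 : 1 - ε ≤ ‖W‖⁻¹ * inner ℝ v W := by
      rw [← real_inner_smul_right, h1]
      have := (abs_le.1 h2).1
      have := Metric.mem_ball.1 hd
      linarith
    calc (1 - ε) * ‖W‖ ≤ ‖W‖⁻¹ * inner ℝ v W * ‖W‖ := by gcongr
      _ = inner ℝ v W := by field_simp

/-- The deviation of `R` from `P` in units of the standard deviations under `P`. -/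
noncomputable def deviation (P R : Simplex S) : S → ℝ := fun i => (R.1 i - P.1 i) / √(P.1 i)

lemma deviation_mul_sqrt {P R : Simplex S} {i : S} (h : P.1 i = 0 → R.1 i = 0) :
    deviation P R i * √(P.1 i) = R.1 i - P.1 i := by
  rcases (P.2.1 i).eq_or_lt with h0 | h0
  · simp [← h0, h h0.symm]
  · exact div_mul_cancel₀ _ (Real.sqrt_pos.2 h0).ne'

/-- With `m` the cost under `R`, the centred loss has `R`-mean zero, so the cost gap pairs `P - R`
with it. Cauchy–Schwarz weighted by `√P` applies, and `R ≥ (1 - η) P` trades the second moment under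
`P` for the variance under `R`. -/
lemma cost_sub_le_deviation (ℓ : X → S → ℝ) (x : X) {P R : Simplex S} {η : ℝ} (hη : η < 1)
    (hsupp : ∀ i, P.1 i = 0 → R.1 i = 0) (hR : ∀ i, (1 - η) * P.1 i ≤ R.1 i) :
    (cost ℓ x P - cost ℓ x R) * √(1 - η) ≤
      √(∑ i, deviation P R i ^ 2) * √(lossVar ℓ x R) := by
  set m := cost ℓ x R
  have hη' : 0 < √(1 - η) := Real.sqrt_pos.2 (by linarith)
  have h1 : cost ℓ x P - m = ∑ i, -deviation P R i * (√(P.1 i) * (ℓ x i - m)) := by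
    have e : ∑ i, R.1 i * (ℓ x i - m) = 0 := by rw [cost_sub]; exact sub_self _
    rw [← cost_sub, ← sub_zero (∑ i, P.1 i * (ℓ x i - m)), ← e, ← Finset.sum_sub_distrib]
    refine Finset.sum_congr rfl fun i _ => ?_
    rw [neg_mul, ← mul_assoc, deviation_mul_sqrt (hsupp i)]
    ring
  have h2 := Real.sum_mul_le_sqrt_mul_sqrt Finset.univ (fun i => -deviation P R i)
    fun i => √(P.1 i) * (ℓ x i - m)
  rw [← h1] at h2
  simp only [neg_sq, mul_pow, Real.sq_sqrt (P.2.1 _)] at h2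
  have h3 : √(∑ i, P.1 i * (ℓ x i - m) ^ 2) * √(1 - η) ≤ √(lossVar ℓ x R) := by
    rw [← Real.sqrt_mul (Finset.sum_nonneg fun i _ => mul_nonneg (P.2.1 i) (sq_nonneg _))]
    refine Real.sqrt_le_sqrt ?_
    rw [lossVar, Finset.sum_mul]
    refine Finset.sum_le_sum fun i _ => ?_
    have := mul_le_mul_of_nonneg_right (hR i) (sq_nonneg (ℓ x i - m))
    linarith
  calc _ ≤ √(∑ i, deviation P R i ^ 2) * √(∑ i, P.1 i * (ℓ x i - m) ^ 2) * √(1 - η) := by gcongr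
    _ ≤ _ := by
      rw [mul_assoc]
      gcongr

/-- A decision can only disappoint under `P` if the empirical distribution is far from `P`. -/
lemma lt_deviation_of_disappointment {ℓ : X → S → ℝ} {a : ℕ+ → ℝ} (ha : ∀ T, 0 ≤ a T) {x : X}
    {P R : Simplex S} {T : ℕ+} {η : ℝ} (hη1 : η < 1)
    (hsupp : ∀ i, P.1 i = 0 → R.1 i = 0)
    (hsmall : ∀ i, 0 < P.1 i → √(1 - η) * √(2 * a T / T) ≤ η * √(P.1 i))
    (hdis : svp ℓ a x R T < cost ℓ x P) :
    √(1 - η) * √(2 * a T / T) < √(∑ i, deviation P R i ^ 2) := by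
  by_contra! hle
  have hη' : 0 < √(1 - η) := Real.sqrt_pos.2 (by linarith)
  -- A small norm bounds each coordinate of the deviation by `η√(P i)`, which is a relative error
  -- `η` in `P i`.
  have hR : ∀ i, (1 - η) * P.1 i ≤ R.1 i := by
    intro i
    rcases (P.2.1 i).eq_or_lt with h0 | h0
    · rw [← h0, mul_zero]; exact R.2.1 i
    · have h1 : |deviation P R i| ≤ √(∑ i, deviation P R i ^ 2) := by
        rw [← Real.sqrt_sq_eq_abs]
        exact Real.sqrt_le_sqrt (Finset.single_le_sum (f := fun i => deviation P R i ^ 2)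
          (fun j _ => sq_nonneg _) (Finset.mem_univ i))
      have h2 := (abs_le.1 (h1.trans (hle.trans (hsmall i h0)))).1
      have h3 := mul_le_mul_of_nonneg_right h2 (Real.sqrt_nonneg (P.1 i))
      rw [deviation_mul_sqrt (hsupp i), neg_mul, mul_assoc, Real.mul_self_sqrt h0.le] at h3
      linarith
  have h1 := cost_sub_le_deviation ℓ x hη1 hsupp hR
  have h2 := h1.trans (mul_le_mul_of_nonneg_right hle (Real.sqrt_nonneg _))
  rw [svp_eq ℓ ha] at hdis
  have h3 : √(2 * a T / T) * √(lossVar ℓ x R) < cost ℓ x P - cost ℓ x R := by linarith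
  have := mul_lt_mul_of_pos_right h3 hη'
  linarith

variable [MeasurableSpace S] [MeasurableSingletonClass S]

/-- The pairing of `v` with the deviation is the empirical mean of the centred function `v i / √(P
i) - m`, whose variance under `P` is at most `∑ v i ^ 2`. -/
lemma samplesLaw_direction (P : Simplex S) {v : S → ℝ} (hv : ∑ i, v i ^ 2 ≤ 1) :
    ∃ B : ℝ, ∀ s, 0 ≤ s → s * B ≤ 1 → ∀ T : ℕ+,
      samplesLaw P {ξ | (∀ i, P.1 i = 0 → (empirical T ξ).1 i = 0) ∧
          s ≤ ∑ i, v i * deviation P (empirical T ξ) i} ≤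
        ENNReal.ofReal (Real.exp (-(T * s ^ 2 * (1 - s * B) / 2))) := by
  set g : S → ℝ := fun i => v i / √(P.1 i) with hg
  set m := ∑ i, P.1 i * g i with hm
  set f : S → ℝ := fun i => g i - m with hf
  have hlin : ∀ R : Simplex S, ∑ i, R.1 i * f i = ∑ i, R.1 i * g i - m := fun R => by
    simp only [hf, mul_sub, Finset.sum_sub_distrib, ← Finset.sum_mul, R.2.2, one_mul]
  have h0 : ∑ i, P.1 i * f i = 0 := by rw [hlin, sub_self]
  have h1 : ∑ i, P.1 i * f i ^ 2 ≤ 1 := by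
    have e : ∑ i, P.1 i * f i ^ 2 = ∑ i, P.1 i * g i ^ 2 - m ^ 2 := by
      have e1 : ∑ i, P.1 i * f i ^ 2 =
          ∑ i, P.1 i * g i ^ 2 - 2 * m * ∑ i, P.1 i * g i + m ^ 2 * ∑ i, P.1 i := by
        rw [Finset.mul_sum _ _ (2 * m), Finset.mul_sum _ _ (m ^ 2), ← Finset.sum_sub_distrib,
          ← Finset.sum_add_distrib]
        exact Finset.sum_congr rfl fun i _ => by simp only [hf]; ring
      rw [e1, P.2.2, ← hm]; ring
    have h2 : ∑ i, P.1 i * g i ^ 2 ≤ ∑ i, v i ^ 2 := by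
      refine Finset.sum_le_sum fun i _ => ?_
      rcases (P.2.1 i).eq_or_lt with hi | hi
      · rw [← hi, zero_mul]; positivity
      · rw [hg, div_pow, Real.sq_sqrt hi.le, mul_div_cancel₀ _ hi.ne']
    have := sq_nonneg m
    linarith
  obtain ⟨B, hB⟩ := (Set.finite_range fun i => |f i|).bddAbove
  refine ⟨B, fun s hs hsB T => (measure_mono ?_).trans
    (samplesLaw_chernoff P f h0 h1 (fun i => hB ⟨i, rfl⟩) hs hsB T)⟩
  rintro ξ ⟨-, h⟩
  refine h.trans (le_of_eq ?_)
  rw [← sub_zero (∑ i, (empirical T ξ).1 i * f i), ← h0, ← Finset.sum_sub_distrib]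
  have e : ∀ i, (empirical T ξ).1 i * f i - P.1 i * f i =
      v i * deviation P (empirical T ξ) i - m * ((empirical T ξ).1 i - P.1 i) := fun i => by
    simp only [deviation, hf, hg]; ring
  simp only [e, Finset.sum_sub_distrib (s := Finset.univ) (f := fun i => v i * _),
    ← Finset.mul_sum, Simplex.sum_sub, mul_zero, sub_zero]

lemma outOfSampleGuarantee_svp (ℓ : X → S → ℝ) {a : ℕ+ → ℝ} (ha : ∀ T, 0 ≤ a T)
    (ha_top : Tendsto a atTop atTop)
    (ha_sub : Tendsto (fun T : ℕ+ => a T / (T : ℝ)) atTop (𝓝 0)) (xV : DecisionRule X S) :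
    OutOfSampleGuarantee ℓ a (svp ℓ a) xV := by
  intro P
  refine limsup_log_le_neg_one ha_top fun κ hκ0 hκ1 => ?_
  -- The radius costs one factor `1 - ε`, the net two and the Chernoff correction one; `(1 - ε)^4 ≥
  -- 1 - 4ε = κ + ε`, and the spare `ε` absorbs the cardinality of the net.
  set ε := (1 - κ) / 5 with hε
  have hε0 : 0 < ε := by rw [hε]; linarith
  have hε1 : ε < 1 := by rw [hε]; linarith
  obtain ⟨N, hN1, hN2⟩ := exists_finset_almost_norming (S := S) hε0
  have hdir := fun v : N => samplesLaw_direction P (hN1 v.1 v.2)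
  choose B hB using hdir
  set r : ℕ+ → ℝ := fun T => √(1 - ε) * √(2 * a T / T) with hr
  have hr0 : Tendsto r atTop (𝓝 0) := by
    simpa only [mul_zero] using (tendsto_sqrt_speed ha_sub 2).const_mul (√(1 - ε))
  have hs0 : Tendsto (fun T => (1 - ε) * r T) atTop (𝓝 0) := by
    simpa only [mul_zero] using hr0.const_mul (1 - ε)
  have hsmall : ∀ᶠ T in atTop, ∀ i, 0 < P.1 i → r T ≤ ε * √(P.1 i) := by
    refine eventually_all.2 fun i => ?_
    by_cases hi : 0 < P.1 i
    · filter_upwards [hr0.eventually (ge_mem_nhds (mul_pos hε0 (Real.sqrt_pos.2 hi)))] with T hT _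
        using hT
    · exact Eventually.of_forall fun T h => absurd h hi
  have hsB : ∀ᶠ T in atTop, ∀ v : N, (1 - ε) * r T * B v ≤ ε := by
    refine eventually_all.2 fun v => ?_
    have := hs0.mul_const (B v)
    rw [zero_mul] at this
    exact this.eventually (ge_mem_nhds hε0)
  have hcard : ∀ᶠ T in atTop, (N.card : ℝ) ≤ Real.exp (ε * a T) :=
    (Real.tendsto_exp_atTop.comp (ha_top.const_mul_atTop hε0)).eventually_ge_atTop _
  filter_upwards [hsmall, hsB, hcard] with T h1 h2 h3
  have hT : (0 : ℝ) < T := by exact_mod_cast T.pos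
  have hsub : {ξ | predOpt (svp ℓ a) xV (empirical T ξ) T < cost ℓ (xV T (empirical T ξ)) P} ⊆
      {ξ | ∃ i, P.1 i = 0 ∧ (empirical T ξ).1 i ≠ 0} ∪ ⋃ v ∈ (Finset.univ : Finset N),
        {ξ | (∀ i, P.1 i = 0 → (empirical T ξ).1 i = 0) ∧
          (1 - ε) * r T ≤ ∑ i, v.1 i * deviation P (empirical T ξ) i} := by
    intro ξ hξ
    by_cases hsupp : ∀ i, P.1 i = 0 → (empirical T ξ).1 i = 0
    · right
      have hlt := lt_deviation_of_disappointment ha hε1 hsupp h1 hξ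
      obtain ⟨v, hv, hle⟩ := hN2 (deviation P (empirical T ξ)) (lt_of_le_of_lt (by positivity) hlt)
      refine Set.mem_iUnion₂.2 ⟨⟨v, hv⟩, Finset.mem_univ _, hsupp, le_trans ?_ hle⟩
      exact mul_le_mul_of_nonneg_left hlt.le (by linarith)
    · left
      push Not at hsupp
      exact hsupp
  have hbound : ∀ v : N, samplesLaw P {ξ | (∀ i, P.1 i = 0 → (empirical T ξ).1 i = 0) ∧
      (1 - ε) * r T ≤ ∑ i, v.1 i * deviation P (empirical T ξ) i} ≤
        ENNReal.ofReal (Real.exp (-((κ + ε) * a T))) := by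
    intro v
    refine (hB v _ (mul_nonneg (by linarith) (by positivity)) ((h2 v).trans hε1.le) T).trans
      (ENNReal.ofReal_le_ofReal (Real.exp_le_exp.2 (neg_le_neg ?_)))
    have hr2 : T * r T ^ 2 = (1 - ε) * (2 * a T) := by
      have : 0 ≤ 2 * a T / (T : ℝ) := div_nonneg (mul_nonneg two_pos.le (ha T)) hT.le
      rw [hr, mul_pow, Real.sq_sqrt (by linarith), Real.sq_sqrt this]
      field_simp
    have e : T * ((1 - ε) * r T) ^ 2 * (1 - (1 - ε) * r T * B v) / 2 =
        (1 - ε) ^ 3 * (1 - (1 - ε) * r T * B v) * a T := by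
      rw [mul_pow, mul_left_comm, hr2]; ring
    rw [e]
    refine mul_le_mul_of_nonneg_right ?_ (ha T)
    have h4 : (1 - ε) ^ 3 * (1 - ε) ≤ (1 - ε) ^ 3 * (1 - (1 - ε) * r T * B v) :=
      mul_le_mul_of_nonneg_left (by linarith [h2 v]) (pow_nonneg (by linarith) 3)
    have h5 : 1 - 4 * ε ≤ (1 - ε) ^ 3 * (1 - ε) := by
      have := one_add_mul_le_pow (a := -ε) (by linarith) 4
      norm_num at this
      calc _ ≤ (1 + -ε) ^ 4 := by linarith
        _ = _ := by ring
    linarith [hε]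
  refine (measure_mono hsub).trans ((measure_union_le _ _).trans ?_)
  rw [samplesLaw_support, zero_add]
  refine (measure_biUnion_finset_le _ _).trans ((Finset.sum_le_sum fun v _ => hbound v).trans ?_)
  rw [Finset.sum_const, Finset.card_univ, Fintype.card_coe, nsmul_eq_mul,
    ← ENNReal.ofReal_natCast, ← ENNReal.ofReal_mul (Nat.cast_nonneg _)]
  refine ENNReal.ofReal_le_ofReal ((mul_le_mul_of_nonneg_right h3 (Real.exp_pos _).le).trans
    (le_of_eq ?_))
  rw [← Real.exp_add]
  congr 1
  ring

end Feasibility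

/-! ### Local expansions uniform in the decision and the data size -/

section Local

variable {X S : Type*} [Fintype S]

lemma Simplex.dist_lt_iff {P Q : Simplex S} {r : ℝ} (hr : 0 < r) :
    dist Q P < r ↔ ∀ i, |Q.1 i - P.1 i| < r := by
  rw [Subtype.dist_eq, dist_pi_lt_iff hr]
  simp only [Real.dist_eq]

lemma Simplex.abs_sub_le_dist (P Q : Simplex S) (i : S) : |Q.1 i - P.1 i| ≤ dist Q P := by
  rw [← Real.dist_eq]
  exact dist_le_pi_dist Q.1 P.1 i

lemma isOpen_simplexInterior : IsOpen (simplexInterior S) := by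
  simp only [simplexInterior, Set.ofPred_forall]
  exact isOpen_iInter_of_finite fun i => isOpen_lt continuous_const
    ((continuous_apply i).comp continuous_subtype_val)

lemma abs_sum_mul_le {g v : S → ℝ} {A B : ℝ} (hg : ∀ i, |g i| ≤ A) (hv : ∀ i, |v i| ≤ B) :
    |∑ i, g i * v i| ≤ Fintype.card S * A * B := by
  refine (Finset.abs_sum_le_sum_abs _ _).trans ?_
  calc _ ≤ ∑ _i : S, A * B := Finset.sum_le_sum fun i _ => by
        rw [abs_mul]
        exact mul_le_mul (hg i) (hv i) (abs_nonneg _) ((abs_nonneg _).trans (hg i))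
    _ = _ := by rw [Finset.sum_const, Finset.card_univ, nsmul_eq_mul, mul_assoc]

variable [TopologicalSpace X] [CompactSpace X]

/-- Near each `(y, P)`, both `(x, Q)` and `(x, P)` are compared with `(y, P)`; compactness of `X`
then makes the neighbourhood of `P` independent of `x`. -/
lemma EquicontinuousOn.eventually_forall_dist_lt {E : Type*} [PseudoMetricSpace E]
    {F : X → Simplex S → ℕ+ → E} {s : Set (Simplex S)} (hs : IsOpen s) {P : Simplex S} (hP : P ∈ s)
    (h : EquicontinuousOn (fun (T : ℕ+) (q : X × Simplex S) => F q.1 q.2 T) {q | q.2 ∈ s})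
    {ε : ℝ} (hε : 0 < ε) : ∀ᶠ Q in 𝓝 P, ∀ x T, dist (F x Q T) (F x P T) < ε := by
  have key : ∀ᶠ Q in 𝓝 P, ∀ x ∈ (Set.univ : Set X), ∀ T, dist (F x Q T) (F x P T) < ε := by
    refine isCompact_univ.eventually_forall_of_forall_eventually fun y _ => ?_
    have hopen : IsOpen {q : X × Simplex S | q.2 ∈ s} := hs.preimage continuous_snd
    have h1 := h (y, P) hP _ (Metric.dist_mem_uniformity (half_pos hε))
    rw [hopen.nhdsWithin_eq hP] at h1
    have t1 : Tendsto (fun z : Simplex S × X => (z.2, z.1)) (𝓝 (P, y)) (𝓝 (y, P)) :=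
      (continuous_snd.prodMk continuous_fst).tendsto (P, y)
    have t2 : Tendsto (fun z : Simplex S × X => (z.2, P)) (𝓝 (P, y)) (𝓝 (y, P)) :=
      (continuous_snd.prodMk continuous_const).tendsto (P, y)
    filter_upwards [t1.eventually h1, t2.eventually h1] with z h2 h3 T
    have h2' : dist (F y P T) (F z.2 z.1 T) < ε / 2 := h2 T
    have h3' : dist (F y P T) (F z.2 P T) < ε / 2 := h3 T
    rw [dist_comm] at h2'
    linarith [dist_triangle (F z.2 z.1 T) (F y P T) (F z.2 P T)]
  filter_upwards [key] with Q hQ x using hQ x (Set.mem_univ x)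

omit [TopologicalSpace X] [CompactSpace X] in
open Classical in
-- An arbitrary extension off the simplex suffices for a derivative within it, and gives access to
-- the mean value inequality on convex sets.
lemma HasSimplexGradientAt.hasFDerivWithinAt {f : Simplex S → ℝ} {g : S → ℝ} {P : Simplex S}
    (h : HasSimplexGradientAt f g P) :
    HasFDerivWithinAt (fun v => if hv : v ∈ stdSimplex ℝ S then f ⟨v, hv⟩ else 0) (linearForm g)
      (stdSimplex ℝ S) P.1 := by
  refine HasFDerivWithinAt.of_isLittleO ?_
  rw [nhdsWithin_eq_map_subtype_coe P.2, Asymptotics.isLittleO_map]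
  refine h.2.congr_left fun Q => ?_
  have hQ := Q.2
  have hP := P.2
  simp [linearForm_apply]

/-- First order expansion of a regular predictor, uniformly in the decision and the data size. -/
lemma eventually_taylor {c : Predictor X S} {G : X → Simplex S → ℕ+ → S → ℝ}
    (hG : ∀ x, ∀ P ∈ simplexInterior S, ∀ T,
      HasSimplexGradientAt (fun Q => c x Q T) (G x P T) P)
    (hGe : EquicontinuousOn (fun (T : ℕ+) (q : X × Simplex S) => G q.1 q.2 T)
      {q | q.2 ∈ simplexInterior S})
    {P : Simplex S} (hP : P ∈ simplexInterior S) {κ : ℝ} (hκ : 0 < κ) :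
    ∀ᶠ Q in 𝓝 P, ∀ x T,
      |c x Q T - c x P T - ∑ i, G x P T i * (Q.1 i - P.1 i)| ≤ κ * dist Q P := by
  classical
  set n : ℝ := (Fintype.card S : ℝ)
  have hn : 0 ≤ n := Nat.cast_nonneg _
  -- In the sup norm, a functional with coefficients at most `A` has norm at most `n * A`; the `+ 1`
  -- avoids dividing by zero.
  have hκ' : 0 < κ / (n + 1) := by positivity
  obtain ⟨δ, hδ, hball⟩ := Metric.eventually_nhds_iff_ball.1
    ((EquicontinuousOn.eventually_forall_dist_lt isOpen_simplexInterior hP hGe hκ').and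
      (isOpen_simplexInterior.mem_nhds hP))
  filter_upwards [Metric.ball_mem_nhds P hδ] with Q hQ x T
  set s : Set (S → ℝ) := stdSimplex ℝ S ∩ Metric.ball P.1 δ
  have hs : Convex ℝ s := (convex_stdSimplex ℝ S).inter (convex_ball _ _)
  set f : (S → ℝ) → ℝ := fun v => if hv : v ∈ stdSimplex ℝ S then c x ⟨v, hv⟩ T else 0 with hf
  set f' : (S → ℝ) → (S → ℝ) →L[ℝ] ℝ := fun v =>
    if hv : v ∈ stdSimplex ℝ S then linearForm (G x ⟨v, hv⟩ T) else 0 with hf'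
  have h1 : ∀ v ∈ s, HasFDerivWithinAt f (f' v) s v := by
    rintro v ⟨hv, hvb⟩
    have h := (hG x ⟨v, hv⟩ (hball ⟨v, hv⟩ hvb).2 T).hasFDerivWithinAt
    simp only [hf', dif_pos hv]
    exact h.mono Set.inter_subset_left
  have h2 : ∀ v ∈ s, ‖f' v - linearForm (G x P T)‖ ≤ κ := by
    rintro v ⟨hv, hvb⟩
    have hd := (hball ⟨v, hv⟩ hvb).1 x T
    simp only [hf', dif_pos hv]
    refine ContinuousLinearMap.opNorm_le_bound _ hκ.le fun w => ?_
    rw [sub_apply, linearForm_apply, linearForm_apply, ← Finset.sum_sub_distrib]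
    simp only [← sub_mul]
    have hb := abs_sum_mul_le (g := fun i => G x ⟨v, hv⟩ T i - G x P T i) (v := w)
      (A := κ / (n + 1)) (B := ‖w‖)
      (fun i => by
        rw [← Real.dist_eq]
        exact (dist_le_pi_dist _ _ i).trans hd.le)
      fun i => norm_le_pi_norm w i
    refine hb.trans (mul_le_mul_of_nonneg_right ?_ (norm_nonneg _))
    rw [mul_div_assoc', div_le_iff₀ (by positivity)]
    nlinarith
  have h3 := hs.norm_image_sub_le_of_norm_hasFDerivWithin_le' h1 h2
    (⟨P.2, Metric.mem_ball_self hδ⟩ : P.1 ∈ s) (⟨Q.2, hQ⟩ : Q.1 ∈ s)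
  have hP2 := P.2
  have hQ2 := Q.2
  simp only [hf, dif_pos hP2, dif_pos hQ2, linearForm_apply, Pi.sub_apply, Subtype.coe_eta,
    ← dist_eq_norm Q.1 P.1] at h3
  exact h3

/-- The cost of the unique optimal decision is nearly optimal to first order. -/
lemma eventually_cost_le_add {ℓ : X → S → ℝ} (hℓ : ∀ i, Continuous fun x => ℓ x i)
    {P : Simplex S} {x₀ : X} (hx₀ : ∀ y, y ≠ x₀ → cost ℓ x₀ P < cost ℓ y P) {κ : ℝ} (hκ : 0 < κ) :
    ∀ᶠ Q in 𝓝 P, ∀ x, cost ℓ x₀ Q - κ * dist Q P ≤ cost ℓ x Q := by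
  set n : ℝ := (Fintype.card S : ℝ)
  have hn : 0 ≤ n := Nat.cast_nonneg _
  have hκ' : 0 < κ / (n + 1) := by positivity
  have hmin : ∀ y, cost ℓ x₀ P ≤ cost ℓ y P := fun y => by
    rcases eq_or_ne y x₀ with rfl | hy
    exacts [le_rfl, (hx₀ y hy).le]
  have hswap : Continuous fun z : Simplex S × X => (z.2, z.1) :=
    continuous_snd.prodMk continuous_fst
  have key : ∀ᶠ Q in 𝓝 P, ∀ x ∈ (Set.univ : Set X),
      cost ℓ x₀ Q - κ * dist Q P ≤ cost ℓ x Q := by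
    refine isCompact_univ.eventually_forall_of_forall_eventually fun y _ => ?_
    -- Near `x₀` the losses are close to those of `x₀`, so the cost difference, nonnegative at `P`,
    -- moves by at most `κ * dist Q P`. Near any other decision, the strict gap given by uniqueness
    -- persists.
    by_cases hy : y = x₀
    · subst hy
      have h : ∀ᶠ z : Simplex S × X in 𝓝 (P, y), ∀ i, |ℓ z.2 i - ℓ y i| < κ / (n + 1) := by
        refine eventually_all.2 fun i => ?_
        have := (((hℓ i).comp continuous_snd).tendsto (P, y)).eventually
          (Metric.ball_mem_nhds (ℓ y i) hκ')
        exact this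
      filter_upwards [h] with z hz
      have h1 := abs_sum_mul_le (g := fun i => ℓ z.2 i - ℓ y i) (v := fun i => z.1.1 i - P.1 i)
        (fun i => (hz i).le) (Simplex.abs_sub_le_dist P z.1)
      have h2 : n * (κ / (n + 1)) ≤ κ := by
        rw [mul_div_assoc', div_le_iff₀ (by positivity)]
        nlinarith
      have h3 := (abs_le.1 (h1.trans (mul_le_mul_of_nonneg_right h2 dist_nonneg))).1
      have h4 : ∑ i, (ℓ z.2 i - ℓ y i) * (z.1.1 i - P.1 i) =
          cost ℓ z.2 z.1 - cost ℓ y z.1 - (cost ℓ z.2 P - cost ℓ y P) := by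
        simp only [cost, ← Finset.sum_sub_distrib]
        exact Finset.sum_congr rfl fun i _ => by ring
      linarith [hmin z.2]
    · have hc : Continuous fun z : Simplex S × X => cost ℓ z.2 z.1 - cost ℓ x₀ z.1 :=
        ((continuous_cost hℓ).comp hswap).sub
          ((continuous_cost hℓ).comp (continuous_const.prodMk continuous_fst))
      filter_upwards [(hc.tendsto (P, y)).eventually (lt_mem_nhds (sub_pos.2 (hx₀ y hy)))]
        with z hz
      have := mul_nonneg hκ.le (dist_nonneg (x := z.1) (y := P))
      linarith
  filter_upwards [key] with Q hQ x using hQ x (Set.mem_univ x)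

end Local

/-! ### Asymptotic consistency of feasible predictors -/

section Consistency

variable {X S : Type*} [Fintype S] [TopologicalSpace X] [CompactSpace X] [MeasurableSpace S]
  [MeasurableSingletonClass S]

lemma tendsto_pnat_cast_atTop : Tendsto (fun T : ℕ+ => (T : ℝ)) atTop atTop :=
  tendsto_natCast_atTop_atTop.comp tendsto_PNat_val_atTop_atTop

lemma tendsto_exp_neg_mul {b : ℕ+ → ℝ} (hb : Tendsto b atTop atTop) {κ : ℝ} (hκ : 0 < κ) :
    Tendsto (fun T => Real.exp (-(κ * b T))) atTop (𝓝 0) :=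
  Real.tendsto_exp_neg_atTop_nhds_zero.comp (hb.const_mul_atTop hκ)

/-- Feasible predictors do not underestimate the optimal cost asymptotically. -/
lemma eventually_le_predOpt_add {ℓ : X → S → ℝ} {a : ℕ+ → ℝ} (ha_top : Tendsto a atTop atTop)
    {c : Predictor X S} {x : DecisionRule X S} (hc : IsFeasible ℓ a c x) (Q : Simplex S) {m η : ℝ}
    (hm : ∀ y, m ≤ cost ℓ y Q) (hη : 0 < η) : ∀ᶠ T in atTop, m - η ≤ predOpt c x Q T := by
  have heq : EquicontinuousOn (fun (T : ℕ+) (q : X × Simplex S) => c q.1 q.2 T)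
      {q | q.2 ∈ (Set.univ : Set (Simplex S))} := hc.1.1.2.1.equicontinuousOn _
  obtain ⟨δ, hδ, hball⟩ := Metric.eventually_nhds_iff_ball.1
    (EquicontinuousOn.eventually_forall_dist_lt isOpen_univ (Set.mem_univ Q) heq hη)
  set s := min δ (1 / 2)
  have hs : 0 < s := lt_min hδ (by norm_num)
  have h1 := (tendsto_exp_neg_mul tendsto_pnat_cast_atTop
    (by positivity : 0 < s ^ 2 / 4)).const_mul (2 * (Fintype.card S : ℝ))
  rw [mul_zero] at h1
  have h2 := eventually_le_exp_of_limsup ha_top (hc.2 Q) (by norm_num : (1 / 2 : ℝ) < 1)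
  have h3 := tendsto_exp_neg_mul ha_top (by norm_num : (0 : ℝ) < 1 / 2)
  filter_upwards [h1.eventually (gt_mem_nhds (by norm_num : (0 : ℝ) < 1 / 2)), h2,
    h3.eventually (gt_mem_nhds (by norm_num : (0 : ℝ) < 1 / 2))] with T hT1 hT2 hT3
  set U : Set (ℕ → S) := {ξ | ∃ i, s ≤ |(empirical T ξ).1 i - Q.1 i|}
  set D : Set (ℕ → S) :=
    {ξ | predOpt c x (empirical T ξ) T < cost ℓ (x T (empirical T ξ)) Q}
  have hU : samplesLaw Q U ≤ ENNReal.ofReal (1 / 2) := by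
    refine (samplesLaw_concentration Q T hs.le (min_le_right _ _)).trans
      (ENNReal.ofReal_le_ofReal (le_trans (le_of_eq ?_) hT1.le))
    congr 2
    ring
  have hlt : samplesLaw Q (U ∪ D) < 1 := by
    calc samplesLaw Q (U ∪ D) ≤ samplesLaw Q U + samplesLaw Q D := measure_union_le _ _
      _ ≤ ENNReal.ofReal (1 / 2) + ENNReal.ofReal (Real.exp (-(1 / 2 * a T))) :=
        add_le_add hU hT2
      _ = ENNReal.ofReal (1 / 2 + Real.exp (-(1 / 2 * a T))) :=
        (ENNReal.ofReal_add (by norm_num) (Real.exp_pos _).le).symm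
      _ < ENNReal.ofReal 1 := (ENNReal.ofReal_lt_ofReal_iff one_pos).2 (by linarith)
      _ = 1 := ENNReal.ofReal_one
  -- One sample that is both typical and not disappointing is enough: at its empirical distribution
  -- the prediction is at least `m`, and equicontinuity carries this to `Q`.
  obtain ⟨ξ, hξ⟩ : ∃ ξ, ξ ∉ U ∪ D := by
    by_contra! hall
    rw [Set.eq_univ_of_forall hall, measure_univ] at hlt
    exact lt_irrefl _ hlt
  simp only [Set.mem_union, not_or] at hξ
  have hR : dist (empirical T ξ) Q < δ := by
    refine lt_of_lt_of_le ((Simplex.dist_lt_iff hs).2 fun i => ?_) (min_le_left _ _)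
    by_contra! hi
    exact hξ.1 ⟨i, hi⟩
  have h4 : cost ℓ (x T (empirical T ξ)) Q ≤ predOpt c x (empirical T ξ) T := not_lt.1 hξ.2
  have h5 := hball _ hR (x T Q) T
  rw [Real.dist_eq] at h5
  have h6 := hc.1.2 T (empirical T ξ) (x T Q)
  have h7 := hm (x T (empirical T ξ))
  have h8 := (abs_lt.1 h5).2
  unfold predOpt at h4 ⊢
  linarith

end Consistency

/-! ### Tilted distributions and the moderate deviation lower bound -/

section Tilt

variable {S : Type*} [Fintype S]

lemma one_sub_mul_log_le {y : ℝ} (hy : |y| ≤ 1 / 2) :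
    (1 - y) * Real.log (1 - y) ≤ -y + y ^ 2 / 2 + 4 * |y| ^ 3 := by
  have h := Real.abs_log_sub_add_sum_range_le (lt_of_le_of_lt hy (by norm_num)) 2
  simp only [Finset.sum_range_succ, Finset.sum_range_zero] at h
  norm_num at h
  have h1 : |y| ^ 3 / (1 - |y|) ≤ 2 * |y| ^ 3 := by
    rw [div_le_iff₀ (by linarith)]
    nlinarith [pow_nonneg (abs_nonneg y) 3]
  have h2 : Real.log (1 - y) ≤ -y - y ^ 2 / 2 + 2 * |y| ^ 3 := by
    linarith [(abs_le.1 (h.trans h1)).2]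
  obtain ⟨hy1, hy2⟩ := abs_le.1 hy
  have h3 := mul_le_mul_of_nonneg_left h2 (by linarith : 0 ≤ 1 - y)
  have h4 : y ^ 3 ≤ |y| ^ 3 := by rw [← abs_pow]; exact le_abs_self _
  have h5 : (1 - y) * |y| ^ 3 ≤ 3 / 2 * |y| ^ 3 :=
    mul_le_mul_of_nonneg_right (by linarith) (pow_nonneg (abs_nonneg y) 3)
  have h6 := pow_nonneg (abs_nonneg y) 3
  have h7 : (1 - y) * (-y - y ^ 2 / 2 + 2 * |y| ^ 3) =
      -y + y ^ 2 / 2 + y ^ 3 / 2 + 2 * ((1 - y) * |y| ^ 3) := by ring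
  linarith

lemma abs_log_one_sub_le {y : ℝ} (hy : |y| ≤ 1 / 2) : |Real.log (1 - y)| ≤ 2 * |y| := by
  have h := Real.abs_log_sub_add_sum_range_le (lt_of_le_of_lt hy (by norm_num)) 0
  simp only [Finset.sum_range_zero, zero_add, pow_one] at h
  refine h.trans ?_
  rw [div_le_iff₀ (by linarith)]
  nlinarith [abs_nonneg y]

/-- The distribution `P` perturbed in the direction of the density `-e`. -/
def tilt (P : Simplex S) (e : S → ℝ) (t : ℝ) (h0 : ∑ i, P.1 i * e i = 0)
    (ht : ∀ i, |t * e i| ≤ 1 / 2) : Simplex S :=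
  ⟨fun i => P.1 i * (1 - t * e i), by
    refine ⟨fun i => mul_nonneg (P.2.1 i) ?_, ?_⟩
    · linarith [(abs_le.1 (ht i)).2]
    · have : ∀ i, P.1 i * (1 - t * e i) = P.1 i - t * (P.1 i * e i) := fun i => by ring
      simp only [this, Finset.sum_sub_distrib, ← Finset.mul_sum, h0, P.2.2, mul_zero, sub_zero]⟩

lemma tilt_mem_simplexInterior {P : Simplex S} (hP : P ∈ simplexInterior S) {e : S → ℝ} {t : ℝ}
    (h0 : ∑ i, P.1 i * e i = 0) (ht : ∀ i, |t * e i| ≤ 1 / 2) :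
    tilt P e t h0 ht ∈ simplexInterior S := fun i =>
  mul_pos (hP i) (by linarith [(abs_le.1 (ht i)).2])

omit [Fintype S] in
lemma abs_mul_le_half {e : S → ℝ} {B t : ℝ} (hB : ∀ i, |e i| ≤ B) (ht : |t| * B ≤ 1 / 2) (i : S) :
    |t * e i| ≤ 1 / 2 := by
  rw [abs_mul]
  exact (mul_le_mul_of_nonneg_left (hB i) (abs_nonneg t)).trans ht

/-- When `R` is the tilt itself this is a relative entropy: its linear term vanishes by `h0` and its
main term is half the second moment. A tolerance `δ * ρ` meets a logarithm of size `2 * ρ * B`, so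
it too costs order `ρ ^ 2`, with the small factor `δ`. -/
lemma sum_mul_log_tilt_le {P : Simplex S} (hP : P ∈ simplexInterior S) {e : S → ℝ} {B ρ δ : ℝ}
    (h0 : ∑ i, P.1 i * e i = 0) (hB : ∀ i, |e i| ≤ B) (hρ : 0 ≤ ρ) (hρB : ρ * B ≤ 1 / 2)
    {R : Simplex S} (hR : ∀ i, |R.1 i - P.1 i * (1 - ρ * e i)| ≤ δ * ρ) :
    ∑ i, R.1 i * Real.log (P.1 i * (1 - ρ * e i) / P.1 i) ≤
      ρ ^ 2 * ((∑ i, P.1 i * e i ^ 2) / 2 + 4 * ρ * B ^ 3 + 2 * Fintype.card S * B * δ) := by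
  have hy : ∀ i, |ρ * e i| ≤ ρ * B := fun i => by
    rw [abs_mul, abs_of_nonneg hρ]
    exact mul_le_mul_of_nonneg_left (hB i) hρ
  have hterm : ∀ i, R.1 i * Real.log (P.1 i * (1 - ρ * e i) / P.1 i) ≤
      -ρ * (P.1 i * e i) + ρ ^ 2 / 2 * (P.1 i * e i ^ 2) + 4 * (ρ * B) ^ 3 * P.1 i +
        2 * B * δ * ρ ^ 2 := by
    intro i
    rw [mul_div_cancel_left₀ _ (hP i).ne']
    have h1 := mul_le_mul_of_nonneg_left (one_sub_mul_log_le ((hy i).trans hρB)) (P.2.1 i)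
    have h2 : |ρ * e i| ^ 3 ≤ (ρ * B) ^ 3 := pow_le_pow_left₀ (abs_nonneg _) (hy i) 3
    have h3 := mul_le_mul_of_nonneg_left h2 (P.2.1 i)
    have h4 : (R.1 i - P.1 i * (1 - ρ * e i)) * Real.log (1 - ρ * e i) ≤
        δ * ρ * (2 * (ρ * B)) := by
      refine (le_abs_self _).trans ?_
      rw [abs_mul]
      refine mul_le_mul (hR i) ((abs_log_one_sub_le ((hy i).trans hρB)).trans ?_) (abs_nonneg _)
        ((abs_nonneg _).trans (hR i))
      linarith [hy i]
    calc R.1 i * Real.log (1 - ρ * e i)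
        = P.1 i * ((1 - ρ * e i) * Real.log (1 - ρ * e i)) +
          (R.1 i - P.1 i * (1 - ρ * e i)) * Real.log (1 - ρ * e i) := by ring
      _ ≤ P.1 i * (-(ρ * e i) + (ρ * e i) ^ 2 / 2 + 4 * |ρ * e i| ^ 3) +
          δ * ρ * (2 * (ρ * B)) := add_le_add h1 h4
      _ ≤ _ := by linarith
  refine (Finset.sum_le_sum fun i _ => hterm i).trans (le_of_eq ?_)
  simp only [Finset.sum_add_distrib, ← Finset.mul_sum, h0, P.2.2, Finset.sum_const,
    Finset.card_univ, nsmul_eq_mul]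
  ring

lemma dist_tilt_le {P Q : Simplex S} {e : S → ℝ} {B t δ : ℝ} (hB : ∀ i, |e i| ≤ B)
    (ht : 0 ≤ B * |t| + δ) (hQ : ∀ i, |Q.1 i - P.1 i * (1 - t * e i)| ≤ δ) :
    dist Q P ≤ B * |t| + δ := by
  rw [Subtype.dist_eq, dist_pi_le_iff ht]
  intro i
  rw [Real.dist_eq]
  have h1 : |P.1 i * (t * e i)| ≤ B * |t| := by
    rw [abs_mul, abs_mul, abs_of_nonneg (P.2.1 i), mul_comm B]
    calc P.1 i * (|t| * |e i|) ≤ 1 * (|t| * |e i|) := by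
          gcongr
          exact Simplex.le_one P i
      _ ≤ |t| * B := by
          rw [one_mul]
          exact mul_le_mul_of_nonneg_left (hB i) (abs_nonneg t)
  have e1 : Q.1 i - P.1 i = (Q.1 i - P.1 i * (1 - t * e i)) - P.1 i * (t * e i) := by ring
  rw [e1]
  refine (abs_sub _ _).trans ?_
  linarith [hQ i]

variable [MeasurableSpace S] [MeasurableSingletonClass S]

/-- Lower bound for the probability of a moderate deviation in a prescribed direction. -/
lemma eventually_le_samplesLaw_tilt {P : Simplex S} (hP : P ∈ simplexInterior S) {e : S → ℝ}
    {B δ θ : ℝ} (h0 : ∑ i, P.1 i * e i = 0) (hB : ∀ i, |e i| ≤ B) (hθ : 0 < θ) (hδ : 0 < δ)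
    (hδθ : 2 * Fintype.card S * B * δ ≤ θ / 2) {ρ : ℕ+ → ℝ} (hρ : ∀ T, 0 ≤ ρ T)
    (hρ0 : Tendsto ρ atTop (𝓝 0)) (hρT : Tendsto (fun T : ℕ+ => T * ρ T ^ 2) atTop atTop) :
    ∀ᶠ T in atTop, ENNReal.ofReal
        (Real.exp (-(T * (ρ T ^ 2 * ((∑ i, P.1 i * e i ^ 2) / 2 + θ)))) * (1 / 2)) ≤
      samplesLaw P {ξ | ∀ i, |(empirical T ξ).1 i - P.1 i * (1 - ρ T * e i)| ≤ δ * ρ T} := by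
  have t1 : Tendsto (fun T => ρ T * B) atTop (𝓝 0) := by simpa using hρ0.mul_const B
  have t2 : Tendsto (fun T => 4 * ρ T * B ^ 3) atTop (𝓝 0) := by
    simpa using (hρ0.const_mul 4).mul_const (B ^ 3)
  have t3 : Tendsto (fun T => δ * ρ T) atTop (𝓝 0) := by simpa using hρ0.const_mul δ
  have t4 := (tendsto_exp_neg_mul hρT (by positivity : 0 < δ ^ 2 / 4)).const_mul
    (2 * (Fintype.card S : ℝ))
  rw [mul_zero] at t4
  filter_upwards [t1.eventually (ge_mem_nhds (by norm_num : (0 : ℝ) < 1 / 2)),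
    t2.eventually (ge_mem_nhds (by positivity : (0 : ℝ) < θ / 2)),
    t3.eventually (ge_mem_nhds (by norm_num : (0 : ℝ) < 1 / 2)),
    t4.eventually (ge_mem_nhds (by norm_num : (0 : ℝ) < 1 / 2))] with T h1 h2 h3 h4
  have hT := abs_mul_le_half hB (t := ρ T) (by rwa [abs_of_nonneg (hρ T)])
  set Q := tilt P e (ρ T) h0 hT
  have hQ : Q ∈ simplexInterior S := tilt_mem_simplexInterior hP h0 hT
  set E : Set (Simplex S) := {R | ∀ i, |R.1 i - P.1 i * (1 - ρ T * e i)| ≤ δ * ρ T}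
  have hL : ∀ R ∈ E, ∑ i, R.1 i * Real.log (Q.1 i / P.1 i) ≤
      ρ T ^ 2 * ((∑ i, P.1 i * e i ^ 2) / 2 + θ) := fun R hR =>
    (sum_mul_log_tilt_le hP h0 hB (hρ T) h1 hR).trans
      (mul_le_mul_of_nonneg_left (by linarith) (sq_nonneg _))
  -- Under the tilted law the event is typical, since `T * ρ T ^ 2 → ∞` puts the sampling noise
  -- below the tolerance `δ * ρ T`.
  have hhalf : ENNReal.ofReal (1 / 2) ≤ samplesLaw Q {ξ | empirical T ξ ∈ E} := by
    have hc := samplesLaw_concentration Q T (mul_nonneg hδ.le (hρ T)) h3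
    have hc' : samplesLaw Q {ξ | ∃ i, δ * ρ T ≤ |(empirical T ξ).1 i - Q.1 i|} ≤
        ENNReal.ofReal (1 / 2) := by
      refine hc.trans (ENNReal.ofReal_le_ofReal (le_trans (le_of_eq ?_) h4))
      congr 2
      ring
    have hcover : (1 : ℝ≥0∞) ≤ samplesLaw Q {ξ | empirical T ξ ∈ E} +
        samplesLaw Q {ξ | ∃ i, δ * ρ T ≤ |(empirical T ξ).1 i - Q.1 i|} := by
      rw [← measure_univ (μ := samplesLaw Q)]
      refine (measure_mono fun ξ _ => ?_).trans (measure_union_le _ _)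
      by_cases h : ∃ i, δ * ρ T ≤ |(empirical T ξ).1 i - Q.1 i|
      · exact Or.inr h
      · push Not at h
        exact Or.inl fun i => (h i).le
    have h5 := hcover.trans (add_le_add_right hc' _)
    have h6 : (1 : ℝ≥0∞) = ENNReal.ofReal (1 / 2) + ENNReal.ofReal (1 / 2) := by
      rw [← ENNReal.ofReal_add (by norm_num) (by norm_num)]
      norm_num
    rw [h6] at h5
    exact (ENNReal.add_le_add_iff_right ENNReal.ofReal_ne_top).1 h5
  rw [ENNReal.ofReal_mul (Real.exp_pos _).le]
  exact (mul_le_mul_right hhalf _).trans (samplesLaw_change_of_measure P Q hP hQ T E hL)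

end Tilt

/-! ### Lower bound for feasible predictors and the comparison -/

section Optimality

variable {X S : Type*} [Fintype S] [TopologicalSpace X] [CompactSpace X] [MeasurableSpace S]
  [MeasurableSingletonClass S]

/-- If a feasible predictor is nearly unbiased at `P`, its derivative at `P` in the direction of
the loss of the optimal decision is at least that of the true cost. -/
lemma eventually_lossVar_le_gradient {ℓ : X → S → ℝ} (hℓ : ∀ i, Continuous fun x => ℓ x i)
    {a : ℕ+ → ℝ} (ha_top : Tendsto a atTop atTop)
    {c : Predictor X S} {x : DecisionRule X S} (hc : IsFeasible ℓ a c x)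
    {G : X → Simplex S → ℕ+ → S → ℝ}
    (hG : ∀ x, ∀ P ∈ simplexInterior S, ∀ T,
      HasSimplexGradientAt (fun Q => c x Q T) (G x P T) P)
    (hGe : EquicontinuousOn (fun (T : ℕ+) (q : X × Simplex S) => G q.1 q.2 T)
      {q | q.2 ∈ simplexInterior S})
    {P : Simplex S} (hP : P ∈ simplexInterior S)
    {x₀ : X} (hx₀ : ∀ y, y ≠ x₀ → cost ℓ x₀ P < cost ℓ y P) {σ : ℕ+ → ℝ}
    (hσ : Tendsto σ atTop (𝓝 0)) {κ : ℝ} (hκ : 0 < κ) :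
    ∀ᶠ T in atTop, predOpt c x P T ≤ cost ℓ x₀ P + σ T →
      lossVar ℓ x₀ P - κ ≤ ∑ i, G (x T P) P T i * (P.1 i * (ℓ x₀ i - cost ℓ x₀ P)) := by
  set e : S → ℝ := fun i => ℓ x₀ i - cost ℓ x₀ P with he
  have h0 : ∑ i, P.1 i * e i = 0 := by rw [cost_sub]; exact sub_self _
  obtain ⟨B', hB'⟩ := (Set.finite_range fun i => |e i|).bddAbove
  set B := max B' 1
  have hB1 : 1 ≤ B := le_max_right _ _
  have hB : ∀ i, |e i| ≤ B := fun i => (hB' ⟨i, rfl⟩).trans (le_max_left _ _)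
  -- Error budget in units of `κ₁ * τ`: `B` each for the Taylor and cost expansions, 1 each for
  -- consistency and `σ T`.
  set κ₁ := κ / (2 * B + 2)
  have hκ₁ : 0 < κ₁ := by positivity
  obtain ⟨δ, hδ, hball⟩ := Metric.eventually_nhds_iff_ball.1
    ((eventually_taylor hG hGe hP hκ₁).and (eventually_cost_le_add hℓ hx₀ hκ₁))
  -- The step does not depend on `T`, because consistency is available only at a fixed `Q`. The two
  -- bounds keep the tilt a probability and inside the ball of radius `δ`.
  set τ := min (1 / (2 * B)) (δ / (2 * B))
  have hτ : 0 < τ := lt_min (by positivity) (by positivity)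
  have hτ1 : B * τ ≤ 1 / 2 := by
    calc B * τ ≤ B * (1 / (2 * B)) := by gcongr; exact min_le_left _ _
      _ = 1 / 2 := by field_simp
  have hτ2 : B * τ < δ := by
    calc B * τ ≤ B * (δ / (2 * B)) := by gcongr; exact min_le_right _ _
      _ = δ / 2 := by field_simp
      _ < δ := half_lt_self hδ
  have habs : |-τ| = τ := by rw [abs_neg, abs_of_pos hτ]
  have ht := abs_mul_le_half hB (t := -τ) (by rw [habs]; linarith)
  -- The negative parameter moves towards larger losses of `x₀`, raising its cost by `τ` times its
  -- variance.
  set Q := tilt P e (-τ) h0 ht with hQdef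
  have hQv : ∀ i, Q.1 i = P.1 i * (1 - -τ * e i) := fun i => rfl
  have hdist : dist Q P ≤ B * τ := by
    have := dist_tilt_le (P := P) (Q := Q) (t := -τ) (δ := 0) hB (by positivity)
      fun i => by rw [hQv, sub_self, abs_zero]
    rwa [habs, add_zero] at this
  obtain ⟨hQ1, hQ2⟩ := hball Q (hdist.trans_lt hτ2)
  have hcost : cost ℓ x₀ Q = cost ℓ x₀ P + τ * lossVar ℓ x₀ P := by
    have e1 : ∑ i, P.1 i * e i * cost ℓ x₀ P = 0 := by rw [← Finset.sum_mul, h0, zero_mul]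
    have e2 : cost ℓ x₀ Q = cost ℓ x₀ P + τ * lossVar ℓ x₀ P +
        τ * ∑ i, P.1 i * e i * cost ℓ x₀ P := by
      rw [cost, cost, lossVar, Finset.mul_sum, Finset.mul_sum, ← Finset.sum_add_distrib,
        ← Finset.sum_add_distrib]
      refine Finset.sum_congr rfl fun i _ => ?_
      rw [hQv]
      simp only [he, cost]
      ring
    rw [e2, e1, mul_zero, add_zero]
  have hcons := eventually_le_predOpt_add ha_top hc Q hQ2 (mul_pos hκ₁ hτ)
  filter_upwards [hcons, hσ.eventually (ge_mem_nhds (mul_pos hκ₁ hτ))] with T h1 h2 h3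
  have h4 := (abs_le.1 (hQ1 (x T P) T)).2
  have h5 : predOpt c x Q T ≤ c (x T P) Q T := hc.1.2 T Q (x T P)
  have h6 : ∑ i, G (x T P) P T i * (Q.1 i - P.1 i) =
      τ * ∑ i, G (x T P) P T i * (P.1 i * e i) := by
    rw [Finset.mul_sum]
    refine Finset.sum_congr rfl fun i _ => ?_
    rw [hQv]; ring
  rw [h6] at h4
  have h7 : κ₁ * dist Q P ≤ κ₁ * (B * τ) := by gcongr
  have h8 : predOpt c x P T = c (x T P) P T := rfl
  have h9 : τ * (lossVar ℓ x₀ P) ≤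
      τ * (∑ i, G (x T P) P T i * (P.1 i * e i) + κ₁ * (2 * B + 2)) := by
    rw [hcost] at h1
    linarith
  have h10 : κ₁ * (2 * B + 2) = κ := div_mul_cancel₀ _ (by positivity)
  have := le_of_mul_le_mul_left h9 hτ
  linarith

/-- Every feasible predictor exceeds the optimal cost by at least the asymptotic excess of sample
variance penalization. -/
lemma eventually_excess_le_predOpt {ℓ : X → S → ℝ} (hℓ : ∀ i, Continuous fun x => ℓ x i)
    {a : ℕ+ → ℝ} (ha : ∀ T, 0 ≤ a T) (ha_top : Tendsto a atTop atTop)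
    (ha_sub : Tendsto (fun T : ℕ+ => a T / (T : ℝ)) atTop (𝓝 0))
    {c : Predictor X S} {x : DecisionRule X S} (hc : IsFeasible ℓ a c x)
    {P : Simplex S} (hP : P ∈ simplexInterior S)
    {x₀ : X} (hx₀ : ∀ y, y ≠ x₀ → cost ℓ x₀ P < cost ℓ y P) (hV : 0 < lossVar ℓ x₀ P)
    {ε : ℝ} (hε0 : 0 < ε) (hε1 : ε < 1) :
    ∀ᶠ T : ℕ+ in atTop,
      cost ℓ x₀ P + (1 - ε) * (√(2 * a T / T) * √(lossVar ℓ x₀ P)) ≤ predOpt c x P T := by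
  obtain ⟨-, -, G, hG, hGb, hGe⟩ := hc.1.1
  obtain ⟨M', hM'⟩ := hGb {P} isCompact_singleton (Set.singleton_subset_iff.2 hP)
  set M := max M' 0
  have hM0 : 0 ≤ M := le_max_right _ _
  have hM : ∀ x T i, |G x P T i| ≤ M := fun x T i =>
    (norm_le_pi_norm (G x P T) i).trans ((hM' x P rfl T).trans (le_max_left _ _))
  set V := lossVar ℓ x₀ P
  set e : S → ℝ := fun i => ℓ x₀ i - cost ℓ x₀ P with he
  have h0 : ∑ i, P.1 i * e i = 0 := by rw [cost_sub]; exact sub_self _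
  have hVe : ∑ i, P.1 i * e i ^ 2 = V := rfl
  obtain ⟨B', hB'⟩ := (Set.finite_range fun i => |e i|).bddAbove
  set B := max B' 0
  have hB0 : 0 ≤ B := le_max_right _ _
  have hB : ∀ i, |e i| ≤ B := fun i => (hB' ⟨i, rfl⟩).trans (le_max_left _ _)
  set n : ℝ := (Fintype.card S : ℝ)
  have hn : 0 ≤ n := Nat.cast_nonneg _
  -- Three errors `ν * ρ` (Taylor remainder, tolerance of the event, gradient bound) must fit in the
  -- margin `ε / 2 * (ρ * V) = 4 * (ν * ρ)`. In the entropy, `ν` only costs the factor `1 + ε / 4`.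
  set ν := V * ε / 8 with hν
  have hν0 : 0 < ν := by positivity
  set δ := min 1 (min (ν / (n * M + 1)) (ν / (4 * (n * B + 1))))
  have hδ0 : 0 < δ := lt_min one_pos (lt_min (by positivity) (by positivity))
  have hδ1 : δ ≤ 1 := min_le_left _ _
  have hδM : n * M * δ ≤ ν := by
    have h : δ ≤ ν / (n * M + 1) := (min_le_right _ _).trans (min_le_left _ _)
    rw [le_div_iff₀ (by positivity)] at h
    linarith
  have hδB : 2 * n * B * δ ≤ ν / 2 := by
    have h : δ ≤ ν / (4 * (n * B + 1)) := (min_le_right _ _).trans (min_le_right _ _)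
    rw [le_div_iff₀ (by positivity)] at h
    nlinarith
  set κ₂ := ν / (B + 1)
  have hκ₂ : 0 < κ₂ := by positivity
  have hsV : 0 < √V := Real.sqrt_pos.2 hV
  -- Chosen so that the leading entropy cost `T * ρ ^ 2 * V / 2` is `(1 - ε / 2) ^ 2 * a`, while `ρ
  -- * V` still exceeds the supposed excess.
  set ρ : ℕ+ → ℝ := fun T => (1 - ε / 2) / √V * √(2 * a T / T) with hρdef
  have hq : 0 < (1 - ε / 2) / √V := div_pos (by linarith) hsV
  have hρ : ∀ T, 0 ≤ ρ T := fun T => mul_nonneg hq.le (Real.sqrt_nonneg _)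
  have hs0 := tendsto_sqrt_speed ha_sub 2
  have hρ0 : Tendsto ρ atTop (𝓝 0) := by simpa only [mul_zero] using hs0.const_mul _
  have hρsq : ∀ T : ℕ+, T * ρ T ^ 2 = (1 - ε / 2) ^ 2 * 2 / V * a T := fun T => by
    have hT : (0 : ℝ) < T := by exact_mod_cast T.pos
    have h1 : 0 ≤ 2 * a T / (T : ℝ) := div_nonneg (mul_nonneg two_pos.le (ha T)) hT.le
    rw [hρdef, mul_pow, div_pow, Real.sq_sqrt h1, Real.sq_sqrt hV.le]
    field_simp
  have hρT : Tendsto (fun T : ℕ+ => T * ρ T ^ 2) atTop atTop := by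
    simp only [hρsq]
    refine ha_top.const_mul_atTop (div_pos (mul_pos (pow_pos (by linarith) 2) two_pos) hV)
  have hσ : Tendsto (fun T : ℕ+ => (1 - ε) * (√(2 * a T / T) * √V)) atTop (𝓝 0) := by
    simpa only [zero_mul, mul_zero] using (hs0.mul_const (√V)).const_mul (1 - ε)
  obtain ⟨r, hr, hball⟩ := Metric.eventually_nhds_iff_ball.1 (eventually_taylor hG hGe hP hκ₂)
  have hρr : Tendsto (fun T => (B + 1) * ρ T) atTop (𝓝 0) := by
    simpa only [mul_zero] using hρ0.const_mul (B + 1)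
  have hexp : Tendsto (fun T => Real.exp (-(ε / 4 * a T))) atTop (𝓝 0) :=
    tendsto_exp_neg_mul ha_top (by positivity)
  filter_upwards [eventually_lossVar_le_gradient hℓ ha_top hc hG hGe hP hx₀ hσ hν0,
    eventually_le_samplesLaw_tilt hP h0 hB hν0 hδ0 hδB hρ hρ0 hρT,
    eventually_le_exp_of_limsup ha_top (hc.2 P) (by linarith : 1 - ε / 4 < 1),
    hρr.eventually (gt_mem_nhds hr), ha_top.eventually_gt_atTop 0,
    hexp.eventually (gt_mem_nhds (by norm_num : (0 : ℝ) < 1 / 2))] with T h1 h2 h3 h4 h5 h6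
  have hT : (0 : ℝ) < T := by exact_mod_cast T.pos
  by_contra! hlt
  have hgrad := h1 hlt.le
  have hρpos : 0 < ρ T := mul_pos hq (Real.sqrt_pos.2 (by positivity))
  -- On this event the decision used at `P` already has predicted cost below the true optimum, and
  -- the prescribed one is predicted no higher; yet no decision beats `x₀` under `P`.
  have hsub : {ξ | ∀ i, |(empirical T ξ).1 i - P.1 i * (1 - ρ T * e i)| ≤ δ * ρ T} ⊆
      {ξ | predOpt c x (empirical T ξ) T < cost ℓ (x T (empirical T ξ)) P} := by
    intro ξ hξ
    set R := empirical T ξ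
    have hξ' : ∀ i, |R.1 i - P.1 i * (1 - ρ T * e i)| ≤ δ * ρ T := hξ
    have hd : dist R P ≤ (B + 1) * ρ T := by
      have h := dist_tilt_le (P := P) (Q := R) hB (by positivity) hξ'
      rw [abs_of_pos hρpos] at h
      nlinarith
    have h7 := (abs_le.1 (hball R (hd.trans_lt h4) (x T P) T)).2
    have h8 : predOpt c x R T ≤ c (x T P) R T := hc.1.2 T R (x T P)
    have h9 : predOpt c x P T = c (x T P) P T := rfl
    have h10 : κ₂ * dist R P ≤ ν * ρ T := by
      calc κ₂ * dist R P ≤ κ₂ * ((B + 1) * ρ T) := by gcongr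
        _ = ν * ρ T := by simp only [κ₂]; field_simp
    have h11 : ∑ i, G (x T P) P T i * (R.1 i - P.1 i) =
        ∑ i, G (x T P) P T i * (R.1 i - P.1 i * (1 - ρ T * e i)) -
          ρ T * ∑ i, G (x T P) P T i * (P.1 i * e i) := by
      rw [Finset.mul_sum, ← Finset.sum_sub_distrib]
      exact Finset.sum_congr rfl fun i _ => by ring
    have h12 := (abs_le.1 (abs_sum_mul_le (hM (x T P) T) hξ')).2
    have h13 : n * M * (δ * ρ T) ≤ ν * ρ T := by
      rw [← mul_assoc]; exact mul_le_mul_of_nonneg_right hδM hρpos.le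
    have h14 : ρ T * (V - ν) ≤ ρ T * ∑ i, G (x T P) P T i * (P.1 i * e i) :=
      mul_le_mul_of_nonneg_left hgrad hρpos.le
    have h15 : (1 - ε) * (√(2 * a T / T) * √V) ≤ (1 - ε / 2) * (ρ T * V) := by
      have e1 : ρ T * V = (1 - ε / 2) * (√(2 * a T / T) * √V) := by
        simp only [hρdef]
        nth_rw 2 [← Real.mul_self_sqrt hV.le]
        field_simp
      have e2 : 1 - ε ≤ (1 - ε / 2) ^ 2 := by nlinarith
      have e3 : 0 ≤ √(2 * a T / T) * √V := by positivity
      have e4 := mul_le_mul_of_nonneg_right e2 e3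
      rw [e1]
      linarith
    have h16 : cost ℓ x₀ P ≤ cost ℓ (x T R) P := by
      rcases eq_or_ne (x T R) x₀ with h | h
      exacts [by rw [h], (hx₀ _ h).le]
    have h17 : 4 * (ν * ρ T) = ε / 2 * (ρ T * V) := by rw [hν]; ring
    have h18 : 0 < ν * ρ T := mul_pos hν0 hρpos
    change predOpt c x R T < cost ℓ (x T R) P
    linarith
  have h7 := (h2.trans (measure_mono hsub)).trans h3
  rw [ENNReal.ofReal_le_ofReal_iff (Real.exp_pos _).le, hVe, ← mul_assoc, hρsq] at h7
  have h8 : (1 - ε / 2) ^ 2 * 2 / V * a T * (V / 2 + ν) ≤ (1 - ε / 2) * a T := by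
    have e1 : (1 - ε / 2) ^ 2 * 2 / V * a T * (V / 2 + ν) =
        (1 - ε / 2) * ((1 - ε / 2) * (1 + ε / 4)) * a T := by
      rw [hν]; field_simp; ring
    rw [e1]
    refine mul_le_mul_of_nonneg_right ?_ h5.le
    refine mul_le_of_le_one_right (by linarith) ?_
    nlinarith
  -- The lower bound decays at rate `1 - ε / 2` and the upper bound at `1 - ε / 4`; the gap `exp(-(ε
  -- / 4) * a)` eventually beats the factor `1 / 2`.
  have h9 : Real.exp (-((1 - ε / 2) * a T)) * (1 / 2) ≤ Real.exp (-((1 - ε / 4) * a T)) :=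
    (mul_le_mul_of_nonneg_right (Real.exp_le_exp.2 (neg_le_neg h8)) (by norm_num)).trans h7
  have h10 : Real.exp (-((1 - ε / 4) * a T)) =
      Real.exp (-((1 - ε / 2) * a T)) * Real.exp (-(ε / 4 * a T)) := by
    rw [← Real.exp_add]; congr 1; ring
  rw [h10] at h9
  have := le_of_mul_le_mul_left h9 (Real.exp_pos _)
  linarith

omit [TopologicalSpace X] [CompactSpace X] [MeasurableSpace S] [MeasurableSingletonClass S] in
lemma optCost_eq {ℓ : X → S → ℝ} {P : Simplex S} {x₀ : X}
    (hx₀ : ∀ y, cost ℓ x₀ P ≤ cost ℓ y P) : optCost ℓ P = cost ℓ x₀ P :=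
  have : Nonempty X := ⟨x₀⟩
  le_antisymm (ciInf_le ⟨cost ℓ x₀ P, by rintro _ ⟨y, rfl⟩; exact hx₀ y⟩ x₀) (le_ciInf hx₀)

omit [TopologicalSpace X] [CompactSpace X] [MeasurableSpace S] [MeasurableSingletonClass S] in
-- Above, `x₀` is a competitor in the penalized problem; below, the penalty is nonnegative and `x₀`
-- minimizes the true cost.
lemma abs_predOpt_svp_sub_le {ℓ : X → S → ℝ} {a : ℕ+ → ℝ} (ha : ∀ T, 0 ≤ a T)
    {xV : DecisionRule X S} (hxV : ∀ T P y, svp ℓ a (xV T P) P T ≤ svp ℓ a y P T)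
    {P : Simplex S} {x₀ : X} (hx₀ : ∀ y, cost ℓ x₀ P ≤ cost ℓ y P) (T : ℕ+) :
    |predOpt (svp ℓ a) xV P T - cost ℓ x₀ P| ≤ √(2 * a T / T) * √(lossVar ℓ x₀ P) := by
  have h1 := hxV T P x₀
  have h2 := hx₀ (xV T P)
  rw [svp_eq ℓ ha, svp_eq ℓ ha] at h1
  rw [predOpt, svp_eq ℓ ha, abs_le]
  have h3 : 0 ≤ √(2 * a T / T) * √(lossVar ℓ (xV T P) P) := by positivity
  have h4 : 0 ≤ √(2 * a T / T) * √(lossVar ℓ x₀ P) := by positivity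
  constructor <;> linarith

lemma errorRatio_zero_le (v : ℝ) : errorRatio 0 v ≤ 1 := by
  unfold errorRatio
  split_ifs <;> simp

lemma errorRatio_le {u v s q : ℝ} (hq : 0 < q) (hs : 0 < s) (hu : u ≤ s) (hv : q * s ≤ v) :
    errorRatio u v ≤ ENNReal.ofReal q⁻¹ := by
  have hv0 : 0 < v := (mul_pos hq hs).trans_le hv
  rw [errorRatio, if_neg (fun h => hv0.ne' h.2), ← ENNReal.ofReal_div_of_pos hv0]
  refine ENNReal.ofReal_le_ofReal ?_
  rw [div_le_iff₀ hv0]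
  calc u ≤ s := hu
    _ = q⁻¹ * (q * s) := by field_simp
    _ ≤ q⁻¹ * v := by gcongr

lemma preferred_svp {ℓ : X → S → ℝ} (hℓ : ∀ i, Continuous fun x => ℓ x i)
    {a : ℕ+ → ℝ} (ha : ∀ T, 0 ≤ a T) (ha_top : Tendsto a atTop atTop)
    (ha_sub : Tendsto (fun T : ℕ+ => a T / (T : ℝ)) atTop (𝓝 0))
    (huniq : ∀ P ∈ simplexInterior S, ∃! x : X, ∀ y : X, cost ℓ x P ≤ cost ℓ y P)
    {xV : DecisionRule X S} (hxV : ∀ T P y, svp ℓ a (xV T P) P T ≤ svp ℓ a y P T)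
    {c : Predictor X S} {x : DecisionRule X S} (hc : IsFeasible ℓ a c x) :
    Preferred ℓ (svp ℓ a) xV c x := by
  intro P hP
  obtain ⟨x₀, hmin, huni⟩ := huniq P hP
  have hx₀ : ∀ y, y ≠ x₀ → cost ℓ x₀ P < cost ℓ y P := fun y hy =>
    lt_of_not_ge fun h => hy (huni y fun z => h.trans (hmin z))
  rw [optCost_eq hmin]
  have hup := abs_predOpt_svp_sub_le ha hxV hmin
  rcases (lossVar_nonneg ℓ x₀ P).eq_or_lt with h0 | hV
  -- With zero variance the SVP error is exactly zero, so the ratio is 0, or 1 by the convention for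
  -- `0 / 0`.
  · refine limsup_le_of_le (by isBoundedDefault) (Eventually.of_forall fun T => ?_)
    have h := hup T
    rw [← h0, Real.sqrt_zero, mul_zero] at h
    rw [le_antisymm h (abs_nonneg _)]
    exact errorRatio_zero_le _
  · have hbound : ∀ ε : ℝ, 0 < ε → ε < 1 →
        limsup (fun T : ℕ+ => errorRatio |predOpt (svp ℓ a) xV P T - cost ℓ x₀ P|
          |predOpt c x P T - cost ℓ x₀ P|) atTop ≤ ENNReal.ofReal (1 - ε)⁻¹ := by
      intro ε hε0 hε1
      refine limsup_le_of_le (by isBoundedDefault) ?_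
      filter_upwards [eventually_excess_le_predOpt hℓ ha ha_top ha_sub hc hP hx₀ hV hε0 hε1,
        ha_top.eventually_gt_atTop 0] with T h1 h2
      have hT : (0 : ℝ) < T := by exact_mod_cast T.pos
      refine errorRatio_le (sub_pos.2 hε1) ?_ (hup T) (le_trans ?_ (le_abs_self _))
      · exact mul_pos (Real.sqrt_pos.2 (by positivity)) (Real.sqrt_pos.2 hV)
      · linarith
    have hlim : Tendsto (fun ε : ℝ => ENNReal.ofReal (1 - ε)⁻¹) (𝓝[>] (0 : ℝ)) (𝓝 1) := by
      have h : ContinuousAt (fun ε : ℝ => (1 - ε)⁻¹) 0 :=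
        (continuousAt_const.sub continuousAt_id).inv₀ (by simp)
      have h' := ENNReal.tendsto_ofReal (h.tendsto.mono_left (nhdsWithin_le_nhds (s := Set.Ioi 0)))
      simpa using h'
    refine ge_of_tendsto hlim ?_
    filter_upwards [Ioo_mem_nhdsGT (zero_lt_one : (0 : ℝ) < 1)] with ε hε using hbound ε hε.1 hε.2

end Optimality
end DataDriven

theorem mainTheorem2 {X S : Type*} [TopologicalSpace X] [CompactSpace X] [Nonempty X]
    [Fintype S] [MeasurableSpace S] [MeasurableSingletonClass S]
    (ℓ : X → S → ℝ) (hℓ : ∀ i, Continuous fun x => ℓ x i)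
    (a : ℕ+ → ℝ) (ha_nonneg : ∀ T, 0 ≤ a T) (ha_top : Tendsto a atTop atTop)
    (ha_sub : Tendsto (fun T : ℕ+ => a T / (T : ℝ)) atTop (𝓝 0))
    (huniq : ∀ P ∈ DataDriven.simplexInterior S,
      ∃! x : X, ∀ y : X, DataDriven.cost ℓ x P ≤ DataDriven.cost ℓ y P) :
    DataDriven.IsRegular (DataDriven.svp ℓ a) ∧
    (∃ xV : DataDriven.DecisionRule X S,
      DataDriven.IsPrescriptorPair (DataDriven.svp ℓ a) xV) ∧
    ∀ xV : DataDriven.DecisionRule X S,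
      DataDriven.IsPrescriptorPair (DataDriven.svp ℓ a) xV →
      DataDriven.IsStronglyOptimal ℓ a (DataDriven.svp ℓ a) xV := by
  refine ⟨DataDriven.isRegular_svp hℓ ha_nonneg ha_sub,
    DataDriven.exists_isPrescriptorPair_svp hℓ ha_nonneg ha_sub, fun xV hxV => ⟨⟨hxV, ?_⟩, ?_⟩⟩
  · exact DataDriven.outOfSampleGuarantee_svp ℓ ha_nonneg ha_top ha_sub xV
  · exact fun c x hc =>
      DataDriven.preferred_svp hℓ ha_nonneg ha_top ha_sub huniq hxV.2 hc
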